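/- Let $\Bbbk$ be a field and let $(H,\bullet,1,\Delta,\epsilon,T)$ be a Hopf algebra over $\Bbbk$. Let $\rightharpoonup$ be a left action and $\leftharpoonup$ a right action of $H$ on itself which form a matched pair of actions, that is: $H$ is a left $H$-module coalgebra with respect to $\rightharpoonup$ and a right $H$-module coalgebra with respect to $\leftharpoonup$, and for all $a,b,c\in H$ (in Sweedler's notation) \begin{align*} &a\rightharpoonup 1=\epsilon(a)1,\qquad 1\leftharpoonup a=\epsilon(a)1,\\ &a\rightharpoonup(b\bullet c)=(a_1\rightharpoonup b_1)\bullet((a_2\leftharpoonup b_2)\rightharpoonup c),\\ &(a\bullet b)\leftharpoonup c=(a\leftharpoonup(b_1\rightharpoonup c_1))\bullet(b_2\leftharpoonup c_2),\\ &a\bullet b=(a_1\rightharpoonup b_1)\bullet(a_2\leftharpoonup b_2). \end{align*} Define $a\cdot b:=a_1\bullet(T(a_2)\rightharpoonup b)$ and $S(a):=a_1\rightharpoonup T(a_2)$. Then the following operations, with unit $1\otimes 1$ and counit $\epsilon\otimes\epsilon$, are a bialgebra structure on $H\otimes H$ with antipode $S_\#$: \begin{align*} (a\otimes h)\cdot_\#(a'\otimes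 h')&:=a\cdot S(h_1)\cdot(h_2\bullet a')\otimes h_3\bullet h',\\ \Delta_\#(a\otimes h)&:=(a_1\otimes a_2\bullet T(a_4)\bullet h_1)\otimes(a_3\otimes h_2),\\ S_\#(a\otimes h)&:=S\big(T(T(a_3)\bullet h_3)\big)\cdot\big(T(T(a_4)\bullet h_2)\bullet T(a_2)\big)\otimes T(a_1\bullet T(a_5)\bullet h_1). \end{align*} Moreover, this is the bosonisation $H^{\cdot}\#H^\bullet$: the coalgebra $(H,\Delta,\epsilon)$ with the product $\cdot$, the unit $1$ and the antipode $S$ is a Hopf algebra in the category of left-left Yetter–Drinfeld modules over $(H,\bullet,1,\Delta,\epsilon,T)$, with the action $\rightharpoonup$ and the adjoint coaction $a\mapsto a_{-1}\otimes a_0:=a_1\bullet T(a_3)\otimes a_2$; and the three operations above are \begin{align*} (a\otimes h)\cdot_\#(a'\otimes h')&=a\cdot(h_1\rightharpoonup a')\otimes h_2\bullet h',\\ \Delta_\#(a\otimes h)&=(a_1\otimes (a_2)_{-1}\bullet h_1)\otimes((a_2)_0\otimes h_2),\\ S_\#(a\otimes h)&=\big(T(a_{-1}\bullet h_2)\rightharpoonup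 S(a_0)\big)\otimes T(a_{-2}\bullet h_1). \end{align*} -/

import Mathlib

open TensorProduct

noncomputable section

namespace Bosonisation

/-! ### Iterated coproducts and Sweedler notation -/

section Sweedler

variable (k : Type*) {H : Type*} [Field k] [AddCommGroup H] [Module k H] [Coalgebra k H]

/-- `a ↦ a₁ ⊗ a₂ ⊗ a₃`. -/
def comul₃ : H →ₗ[k] H ⊗[k] (H ⊗[k] H) :=
  (Coalgebra.comul (R := k) (A := H)).lTensor H ∘ₗ Coalgebra.comul

/-- `a ↦ a₁ ⊗ a₂ ⊗ a₃ ⊗ a₄`. -/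
def comul₄ : H →ₗ[k] H ⊗[k] (H ⊗[k] (H ⊗[k] H)) :=
  (comul₃ k (H := H)).lTensor H ∘ₗ Coalgebra.comul

/-- `a ↦ a₁ ⊗ a₂ ⊗ a₃ ⊗ a₄ ⊗ a₅`. -/
def comul₅ : H →ₗ[k] H ⊗[k] (H ⊗[k] (H ⊗[k] (H ⊗[k] H))) :=
  (comul₄ k (H := H)).lTensor H ∘ₗ Coalgebra.comul

variable {ι : Type} [Fintype ι]

/-- The families `a₁, a₂` (finitely many summands) represent `Δ a = a₁ ⊗ a₂`. -/
def Sweedler₂ (a : H) (a₁ a₂ : ι → H) : Prop :=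
  Coalgebra.comul (R := k) a = ∑ i, a₁ i ⊗ₜ[k] a₂ i

/-- The families represent the twice iterated coproduct `a₁ ⊗ a₂ ⊗ a₃`. -/
def Sweedler₃ (a : H) (a₁ a₂ a₃ : ι → H) : Prop :=
  comul₃ k a = ∑ i, a₁ i ⊗ₜ[k] (a₂ i ⊗ₜ[k] a₃ i)

/-- The families represent the iterated coproduct `a₁ ⊗ a₂ ⊗ a₃ ⊗ a₄`. -/
def Sweedler₄ (a : H) (a₁ a₂ a₃ a₄ : ι → H) : Prop :=
  comul₄ k a = ∑ i, a₁ i ⊗ₜ[k] (a₂ i ⊗ₜ[k] (a₃ i ⊗ₜ[k] a₄ i))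

/-- The families represent the iterated coproduct `a₁ ⊗ a₂ ⊗ a₃ ⊗ a₄ ⊗ a₅`. -/
def Sweedler₅ (a : H) (a₁ a₂ a₃ a₄ a₅ : ι → H) : Prop :=
  comul₅ k a = ∑ i, a₁ i ⊗ₜ[k] (a₂ i ⊗ₜ[k] (a₃ i ⊗ₜ[k] (a₄ i ⊗ₜ[k] a₅ i)))

end Sweedler

/-! ### Bialgebra and Hopf algebra structures on a fixed vector space -/

section HopfStructure

variable {k V : Type*} [Field k] [AddCommGroup V] [Module k V]

/-- The operations make the vector space `V` into a bialgebra over `k`. -/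
structure IsBialgebraStructure (mul : V →ₗ[k] V →ₗ[k] V) (one : V)
    (comul : V →ₗ[k] V ⊗[k] V) (counit : V →ₗ[k] k) : Prop where
  mul_assoc : ∀ x y z, mul (mul x y) z = mul x (mul y z)
  one_mul : ∀ x, mul one x = x
  mul_one : ∀ x, mul x one = x
  coassoc : TensorProduct.assoc k V V V ∘ₗ comul.rTensor V ∘ₗ comul = comul.lTensor V ∘ₗ comul
  rTensor_counit_comp_comul : counit.rTensor V ∘ₗ comul = TensorProduct.mk k k V 1
  lTensor_counit_comp_comul : counit.lTensor V ∘ₗ comul = (TensorProduct.mk k V k).flip 1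
  counit_one : counit one = 1
  counit_mul : ∀ x y, counit (mul x y) = counit x * counit y
  comul_one : comul one = one ⊗ₜ[k] one
  comul_mul : ∀ x y, comul (mul x y) = TensorProduct.map₂ mul mul (comul x) (comul y)

/-- `S` is an antipode: `S(x₁) x₂ = ε(x) 1 = x₁ S(x₂)`. -/
structure IsAntipode (mul : V →ₗ[k] V →ₗ[k] V) (one : V)
    (comul : V →ₗ[k] V ⊗[k] V) (counit : V →ₗ[k] k) (S : V →ₗ[k] V) : Prop where
  left_inv : ∀ x, TensorProduct.lift mul (S.rTensor V (comul x)) = counit x • one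
  right_inv : ∀ x, TensorProduct.lift mul (S.lTensor V (comul x)) = counit x • one

variable {mul : V →ₗ[k] V →ₗ[k] V} {one : V}
  {comul : V →ₗ[k] V ⊗[k] V} {counit : V →ₗ[k] k} {S : V →ₗ[k] V}

/-- The ring structure of a bialgebra structure; the addition is the given one. -/
abbrev IsBialgebraStructure.ring (h : IsBialgebraStructure mul one comul counit) : Ring V where
  __ := (inferInstance : AddCommGroup V)
  mul x y := mul x y
  one := one
  mul_assoc := h.mul_assoc
  one_mul := h.one_mul
  mul_one := h.mul_one
  left_distrib x y z := map_add (mul x) y z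
  right_distrib x y z := LinearMap.map_add₂ mul x y z
  zero_mul x := LinearMap.map_zero₂ mul x
  mul_zero x := map_zero (mul x)

/-- The algebra structure of a bialgebra structure; scalar multiplication is the given one. -/
abbrev IsBialgebraStructure.algebra (h : IsBialgebraStructure mul one comul counit) :
    letI := h.ring; Algebra k V :=
  letI := h.ring
  Algebra.ofModule (fun r x y => LinearMap.map_smul₂ mul r x y) (fun r x y => map_smul (mul x) r y)

/-- The given operations yield a Hopf algebra in the sense of Mathlib. -/
abbrev IsBialgebraStructure.hopfAlgebra (h : IsBialgebraStructure mul one comul counit)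
    (hS : IsAntipode mul one comul counit S) : letI := h.ring; HopfAlgebra k V :=
  letI := h.ring
  letI := h.algebra
  letI : Coalgebra k V :=
    { comul := comul
      counit := counit
      coassoc := h.coassoc
      rTensor_counit_comp_comul := h.rTensor_counit_comp_comul
      lTensor_counit_comp_comul := h.lTensor_counit_comp_comul }
  letI : Bialgebra k V := Bialgebra.mk' k V h.counit_one (h.counit_mul _ _) h.comul_one (by
    intro x y
    have key : ∀ s t : V ⊗[k] V, TensorProduct.map₂ mul mul s t = s * t := by
      intro s t
      induction s with
      | zero => rw [zero_mul]; exact LinearMap.map_zero₂ _ t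
      | add s₁ s₂ h₁ h₂ => rw [add_mul, ← h₁, ← h₂]; exact LinearMap.map_add₂ _ s₁ s₂ t
      | tmul a b =>
        induction t with
        | zero => rw [mul_zero, map_zero]
        | add t₁ t₂ h₁ h₂ => rw [mul_add, map_add, h₁, h₂]
        | tmul c d => exact (Algebra.TensorProduct.tmul_mul_tmul (R := k) a c b d).symm
    exact (h.comul_mul x y).trans (key _ _))
  { antipode := S
    mul_antipode_rTensor_comul := by
      ext x
      exact (hS.left_inv x).trans (Algebra.algebraMap_eq_smul_one _).symm
    mul_antipode_lTensor_comul := by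
      ext x
      exact (hS.right_inv x).trans (Algebra.algebraMap_eq_smul_one _).symm }

end HopfStructure

/-! ### Yetter–Drinfeld modules, and Hopf algebras among them -/

section YetterDrinfeld

variable {k H : Type*} [Field k] [Ring H] [HopfAlgebra k H]

section Tensor

variable {B C : Type*} [AddCommGroup B] [Module k B] [AddCommGroup C] [Module k C]

/-- The diagonal action on a tensor product, `a ⇀ (b ⊗ c) = (a₁ ⇀ b) ⊗ (a₂ ⇀ c)`. -/
def actTensor (actB : H →ₗ[k] B →ₗ[k] B) (actC : H →ₗ[k] C →ₗ[k] C) :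
    H →ₗ[k] B ⊗[k] C →ₗ[k] B ⊗[k] C :=
  TensorProduct.map₂ actB actC ∘ₗ Coalgebra.comul

/-- The diagonal coaction on a tensor product, `b ⊗ c ↦ b₋₁ c₋₁ ⊗ (b₀ ⊗ c₀)`. -/
def coactTensor (coactB : B →ₗ[k] H ⊗[k] B) (coactC : C →ₗ[k] H ⊗[k] C) :
    B ⊗[k] C →ₗ[k] H ⊗[k] (B ⊗[k] C) :=
  (LinearMap.mul' k H).rTensor (B ⊗[k] C) ∘ₗ
    (TensorProduct.tensorTensorTensorComm k H B H C).toLinearMap ∘ₗ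
    TensorProduct.map coactB coactC

end Tensor

variable {B : Type*} [AddCommGroup B] [Module k B]

/-- `B` with the given action and coaction is a left-left Yetter–Drinfeld module over `H`. -/
structure IsYetterDrinfeld (act : H →ₗ[k] B →ₗ[k] B) (coact : B →ₗ[k] H ⊗[k] B) : Prop where
  one_act : ∀ x, act 1 x = x
  mul_act : ∀ a b x, act (a * b) x = act a (act b x)
  counit_coact : ∀ x, (Coalgebra.counit (R := k) (A := H)).rTensor B (coact x) = 1 ⊗ₜ[k] x
  coassoc_coact : TensorProduct.assoc k H H B ∘ₗ
      (Coalgebra.comul (R := k) (A := H)).rTensor B ∘ₗ coact = coact.lTensor H ∘ₗ coact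
  /-- `ρ(a ⇀ x) = a₁ x₋₁ T(a₃) ⊗ (a₂ ⇀ x₀)` -/
  coact_act : ∀ (a : H) (x : B) {ι : Type} [Fintype ι] (a₁ a₂ a₃ : ι → H),
    Sweedler₃ k a a₁ a₂ a₃ →
    coact (act a x) = ∑ i, TensorProduct.map
      (LinearMap.mulLeft k (a₁ i) ∘ₗ LinearMap.mulRight k (HopfAlgebra.antipode k (a₃ i)))
      (act (a₂ i)) (coact x)

/-- The braiding of Yetter–Drinfeld modules, `b ⊗ c ↦ (b₋₁ ⇀ c) ⊗ b₀`. -/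
def braiding (act : H →ₗ[k] B →ₗ[k] B) (coact : B →ₗ[k] H ⊗[k] B) :
    B ⊗[k] B →ₗ[k] B ⊗[k] B :=
  (TensorProduct.lift act).rTensor B ∘ₗ
    (TensorProduct.rightComm k H B B).toLinearMap ∘ₗ coact.rTensor B

/-- The multiplication of `B ⊗ B` twisted by `σ`, that is,
`(m ⊗ m) (id ⊗ σ ⊗ id)` on `(B ⊗ B) ⊗ (B ⊗ B)`. -/
def braidedMul (σ : B ⊗[k] B →ₗ[k] B ⊗[k] B) (mul : B →ₗ[k] B →ₗ[k] B) :
    (B ⊗[k] B) ⊗[k] (B ⊗[k] B) →ₗ[k] B ⊗[k] B :=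
  TensorProduct.map (TensorProduct.lift mul) (TensorProduct.lift mul) ∘ₗ
    (TensorProduct.assoc k B B (B ⊗[k] B)).symm.toLinearMap ∘ₗ
    LinearMap.lTensor B ((TensorProduct.assoc k B B B).toLinearMap ∘ₗ σ.rTensor B ∘ₗ
      (TensorProduct.assoc k B B B).symm.toLinearMap) ∘ₗ
    (TensorProduct.assoc k B B (B ⊗[k] B)).toLinearMap

/-- The coalgebra `B`, with the given action, coaction, multiplication, unit and antipode, is a
Hopf algebra in the braided category of Yetter–Drinfeld modules over `H`. -/
structure IsYetterDrinfeldHopf [Coalgebra k B]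
    (act : H →ₗ[k] B →ₗ[k] B) (coact : B →ₗ[k] H ⊗[k] B)
    (mul : B →ₗ[k] B →ₗ[k] B) (one : B) (S : B →ₗ[k] B) : Prop where
  yetterDrinfeld : IsYetterDrinfeld act coact
  -- an associative unital algebra whose structure maps are linear and colinear
  mul_assoc : ∀ x y z, mul (mul x y) z = mul x (mul y z)
  one_mul : ∀ x, mul one x = x
  mul_one : ∀ x, mul x one = x
  act_mul : ∀ a, act a ∘ₗ TensorProduct.lift mul = TensorProduct.lift mul ∘ₗ actTensor act act a
  coact_mul : coact ∘ₗ TensorProduct.lift mul =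
    (TensorProduct.lift mul).lTensor H ∘ₗ coactTensor coact coact
  act_one : ∀ a, act a one = Coalgebra.counit (R := k) a • one
  coact_one : coact one = 1 ⊗ₜ[k] one
  -- the structure maps of the coalgebra are linear and colinear
  comul_act : ∀ a, Coalgebra.comul ∘ₗ act a = actTensor act act a ∘ₗ Coalgebra.comul
  comul_coact : (Coalgebra.comul (R := k) (A := B)).lTensor H ∘ₗ coact =
    coactTensor coact coact ∘ₗ Coalgebra.comul
  counit_act : ∀ a x, Coalgebra.counit (R := k) (act a x) =
    Coalgebra.counit (R := k) a * Coalgebra.counit (R := k) x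
  counit_coact : ∀ x, (Coalgebra.counit (R := k) (A := B)).lTensor H (coact x) =
    1 ⊗ₜ[k] Coalgebra.counit (R := k) x
  -- the comultiplication and the counit are multiplicative
  comul_mul : ∀ x y, Coalgebra.comul (R := k) (mul x y) =
    braidedMul (braiding act coact) mul
      (Coalgebra.comul (R := k) x ⊗ₜ[k] Coalgebra.comul (R := k) y)
  comul_one : Coalgebra.comul (R := k) one = one ⊗ₜ[k] one
  counit_mul : ∀ x y, Coalgebra.counit (R := k) (mul x y) =
    Coalgebra.counit (R := k) x * Coalgebra.counit (R := k) y
  counit_one : Coalgebra.counit (R := k) one = 1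
  -- the antipode
  antipode : IsAntipode mul one Coalgebra.comul Coalgebra.counit S
  antipode_act : ∀ a x, S (act a x) = act a (S x)
  antipode_coact : coact ∘ₗ S = S.lTensor H ∘ₗ coact

/-! ### The bosonisation `B # H` on the vector space `B ⊗ H` -/

/-- The smash product `(b ⊗ h) (b' ⊗ h') = b · (h₁ ⇀ b') ⊗ h₂ h'`. -/
def smashMul (act : H →ₗ[k] B →ₗ[k] B) (mul : B →ₗ[k] B →ₗ[k] B) :
    B ⊗[k] H →ₗ[k] B ⊗[k] H →ₗ[k] B ⊗[k] H :=
  TensorProduct.lift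
    ((LinearMap.mul k (Module.End k (B ⊗[k] H))).compl₁₂
      (LinearMap.rTensorHom H ∘ₗ mul) (actTensor act (LinearMap.mul k H)))

/-- The smash coproduct `b ⊗ h ↦ (b₁ ⊗ (b₂)₋₁ h₁) ⊗ ((b₂)₀ ⊗ h₂)`. -/
def smashComul [Coalgebra k B] (coact : B →ₗ[k] H ⊗[k] B) :
    B ⊗[k] H →ₗ[k] (B ⊗[k] H) ⊗[k] (B ⊗[k] H) :=
  (TensorProduct.assoc k B H (B ⊗[k] H)).symm.toLinearMap ∘ₗ
    (coactTensor coact (Coalgebra.comul (R := k) (A := H))).lTensor B ∘ₗ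
    (TensorProduct.assoc k B B H).toLinearMap ∘ₗ
    (Coalgebra.comul (R := k) (A := B)).rTensor H

/-- The counit `b ⊗ h ↦ ε(b) ε(h)`. -/
def smashCounit [Coalgebra k B] : B ⊗[k] H →ₗ[k] k :=
  LinearMap.mul' k k ∘ₗ
    TensorProduct.map (Coalgebra.counit (R := k) (A := B)) (Coalgebra.counit (R := k) (A := H))

/-- The antipode `b ⊗ h ↦ (T(x₂) ⇀ S(b₀)) ⊗ T(x₁)` where `x = b₋₁ h`, that is,
`b ⊗ h ↦ (T(b₋₁ h₂) ⇀ S(b₀)) ⊗ T(b₋₂ h₁)`. -/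
def smashAntipode (act : H →ₗ[k] B →ₗ[k] B) (coact : B →ₗ[k] H ⊗[k] B) (S : B →ₗ[k] B) :
    B ⊗[k] H →ₗ[k] B ⊗[k] H :=
  TensorProduct.map (TensorProduct.lift (act.compl₁₂ (HopfAlgebra.antipode k) S))
      (HopfAlgebra.antipode k) ∘ₗ
    (TensorProduct.comm k H (H ⊗[k] B)).toLinearMap ∘ₗ
    (TensorProduct.assoc k H H B).toLinearMap ∘ₗ
    (Coalgebra.comul (R := k) (A := H)).rTensor B ∘ₗ
    (LinearMap.mul' k H).rTensor B ∘ₗ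
    (TensorProduct.rightComm k H B H).toLinearMap ∘ₗ
    coact.rTensor H

end YetterDrinfeld

/-! ### Matched pairs of actions -/

section MatchedPair

variable (k H : Type*) [Field k] [Ring H] [HopfAlgebra k H]

/-- A matched pair of actions on `H`. Here `left a b` is `a ⇀ b`, `right a b` is `a ↼ b`, and
`Δ(a ⊗ b) = (a₁ ⊗ b₁) ⊗ (a₂ ⊗ b₂)` is the tensor product coalgebra structure of `H ⊗ H`. -/
structure MatchedPair where
  left : H →ₗ[k] H →ₗ[k] H
  right : H →ₗ[k] H →ₗ[k] H
  one_left : ∀ b, left 1 b = b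
  mul_left : ∀ a b c, left (a * b) c = left a (left b c)
  right_one : ∀ a, right a 1 = a
  right_mul : ∀ a b c, right a (b * c) = right (right a b) c
  /-- `Δ(a ⇀ b) = (a₁ ⇀ b₁) ⊗ (a₂ ⇀ b₂)` -/
  comul_left : ∀ a b, Coalgebra.comul (R := k) (left a b) =
    TensorProduct.map (TensorProduct.lift left) (TensorProduct.lift left)
      (Coalgebra.comul (R := k) (a ⊗ₜ[k] b))
  counit_left : ∀ a b, Coalgebra.counit (R := k) (left a b) =
    Coalgebra.counit (R := k) a * Coalgebra.counit (R := k) b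
  /-- `Δ(a ↼ b) = (a₁ ↼ b₁) ⊗ (a₂ ↼ b₂)` -/
  comul_right : ∀ a b, Coalgebra.comul (R := k) (right a b) =
    TensorProduct.map (TensorProduct.lift right) (TensorProduct.lift right)
      (Coalgebra.comul (R := k) (a ⊗ₜ[k] b))
  counit_right : ∀ a b, Coalgebra.counit (R := k) (right a b) =
    Coalgebra.counit (R := k) a * Coalgebra.counit (R := k) b
  left_one : ∀ a, left a 1 = Coalgebra.counit (R := k) a • 1
  one_right : ∀ a, right 1 a = Coalgebra.counit (R := k) a • 1
  /-- `a ⇀ (b c) = (a₁ ⇀ b₁) ((a₂ ↼ b₂) ⇀ c)` -/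
  left_mul : ∀ a b c, left a (b * c) =
    LinearMap.mul' k H (TensorProduct.map (TensorProduct.lift left)
      (left.flip c ∘ₗ TensorProduct.lift right) (Coalgebra.comul (R := k) (a ⊗ₜ[k] b)))
  /-- `(a b) ↼ c = (a ↼ (b₁ ⇀ c₁)) (b₂ ↼ c₂)` -/
  mul_right : ∀ a b c, right (a * b) c =
    LinearMap.mul' k H (TensorProduct.map (right a ∘ₗ TensorProduct.lift left)
      (TensorProduct.lift right) (Coalgebra.comul (R := k) (b ⊗ₜ[k] c)))
  /-- `a b = (a₁ ⇀ b₁) (a₂ ↼ b₂)` -/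
  braided_comm : ∀ a b, a * b =
    LinearMap.mul' k H (TensorProduct.map (TensorProduct.lift left)
      (TensorProduct.lift right) (Coalgebra.comul (R := k) (a ⊗ₜ[k] b)))

variable {k H}

/-- The second multiplication `a · b = a₁ (T(a₂) ⇀ b)`. -/
def MatchedPair.dot (P : MatchedPair k H) : H →ₗ[k] H →ₗ[k] H :=
  TensorProduct.lift ((LinearMap.mul k (Module.End k H)).compl₁₂
    (LinearMap.mul k H) (P.left ∘ₗ HopfAlgebra.antipode k)) ∘ₗ Coalgebra.comul

/-- The map `S(a) = a₁ ⇀ T(a₂)`. -/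
def MatchedPair.S (P : MatchedPair k H) : H →ₗ[k] H :=
  TensorProduct.lift (P.left.compl₂ (HopfAlgebra.antipode k)) ∘ₗ Coalgebra.comul

variable (k H)

/-- The left adjoint coaction `a ↦ a₁ T(a₃) ⊗ a₂`. -/
def adjointCoaction : H →ₗ[k] H ⊗[k] H :=
  (LinearMap.mul' k H ∘ₗ (HopfAlgebra.antipode k).lTensor H).rTensor H ∘ₗ
    (TensorProduct.assoc k H H H).symm.toLinearMap ∘ₗ
    (TensorProduct.comm k H H).toLinearMap.lTensor H ∘ₗ comul₃ k

end MatchedPair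

end Bosonisation

end

open TensorProduct

noncomputable section

namespace Bosonisation

open WithConv Coalgebra

/-! ### Convolution rings -/

/-! Sweedler calculus is replaced by computations in groups. For a coalgebra C and an algebra A the
linear maps C → A form a convolution ring. An algebra homomorphism out of a Hopf algebra is a unit
there, its inverse being composition with T, and units pull back along coalgebra homomorphisms. Let
M(a) be left multiplication by a and L(a) the operator a ⇀ -, both units among the maps H → End H.
Then D(a) = (a · -) is the unit D = M L⁻¹. Over H ⊗ H, with variables a and b, the matched pair
axioms read φ(ab) = φ(a ⇀ b) φ(a ↼ b) for every algebra homomorphism φ, and L(a) M(b) = M(a ⇀ b) L(a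
↼ b). Eliminating ↼ gives L(a) D(b) = D(a ⇀ b) L(a) (`leftRep_mul_dotUnit`), and then D(ab) = D(a)
D(a ⇀ b) (`dotUnit_mulHom`). Since D L = M says a₁ · (a₂ ⇀ b) = ab, and a ⊗ b ↦ a₁ ⊗ (a₂ ⇀ b) is
onto (`hom_ext`), it follows that D(a · b) = D(a) D(b), which is associativity. Moreover S is L
applied to T, so D applied to S is M applied to T, which is ε; hence D ∘ S = D⁻¹ and S is an
antipode.

The adjoint coaction is a conjugation, ρ = ι₁ ι₂ ι₁⁻¹ for the two inclusions H → H ⊗ H.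
Multiplicativity of Δ makes ι₂(a ⇀ b) commute with ι₁(a ↼ b) (`commute_leftHom_rightHom`). The
Yetter–Drinfeld condition and the colinearity of · and S are then manipulations of conjugates.
Finally, Δ turns M L⁻¹ into M₁ M₂ (L₁ L₂)⁻¹ = D₁ (L₁ D₂ L₁⁻¹), and the bracket is the part of the
braided product that contains the braiding.

The bosonisation is treated for any Yetter–Drinfeld Hopf algebra B. An algebra homomorphism out of
the smash product amounts to a pair with ψ(h) φ(b) = φ(h₁ ⇀ b) ψ(h₂). Both Δ and ε come from such
pairs, so the bialgebra axioms need checking only on generators; the antipode is checked on products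
i(b) j(h). The displayed formulas follow from D⁻¹ M = L, that is a ⇀ b = S(a₁) · (a₂ b), and from
T(a₁) ⇀ S(a₂) = T(a). -/

/-- The convolution ring of linear maps from a coalgebra to an algebra. -/
abbrev Conv (k C A : Type*) [Field k] [AddCommGroup C] [Module k C] [Ring A] [Algebra k A] :=
  WithConv (C →ₗ[k] A)

section Convolution

variable {k C D A A' : Type*} [Field k] [AddCommGroup C] [Module k C] [Coalgebra k C]
  [AddCommGroup D] [Module k D] [Coalgebra k D] [Ring A] [Algebra k A] [Ring A'] [Algebra k A']

omit [Coalgebra k C] in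
theorem Conv.ext_apply {f g : Conv k C A} (h : ∀ c, f c = g c) : f = g :=
  WithConv.ext (LinearMap.ext h)

/-- Composition with an algebra homomorphism is multiplicative for the convolution. -/
def convPost (φ : A →ₐ[k] A') : Conv k C A →* Conv k C A' where
  toFun f := toConv (φ.toLinearMap ∘ₗ f.ofConv)
  map_one' := by
    refine Conv.ext_apply fun c => ?_
    simp [LinearMap.convOne_def]
  map_mul' f g := by
    rw [LinearMap.algHom_comp_convMul_distrib]

@[simp]
theorem convPost_apply (φ : A →ₐ[k] A') (f : Conv k C A) (c : C) : convPost φ f c = φ (f c) := rfl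

/-- Composition with a coalgebra homomorphism is multiplicative for the convolution. -/
def convPre (f : C →ₗc[k] D) : Conv k D A →* Conv k C A where
  toFun g := toConv (g.ofConv ∘ₗ f.toLinearMap)
  map_one' := by
    refine Conv.ext_apply fun c => ?_
    simp [LinearMap.convOne_def]
  map_mul' g h := by
    rw [LinearMap.convMul_comp_coalgHom_distrib]

@[simp]
theorem convPre_apply (f : C →ₗc[k] D) (g : Conv k D A) (c : C) : convPre f g c = g (f c) := rfl

variable (k C D) in
/-- The projection `c ⊗ d ↦ ε(d) c`. -/
def fstHom : C ⊗[k] D →ₗc[k] C :=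
  (Coalgebra.TensorProduct.rid k k C).toCoalgHom.comp
    (Coalgebra.TensorProduct.map (CoalgHom.id k C) (counitCoalgHom k D))

variable (k C D) in
/-- The projection `c ⊗ d ↦ ε(c) d`. -/
def sndHom : C ⊗[k] D →ₗc[k] D :=
  (Coalgebra.TensorProduct.lid k D).toCoalgHom.comp
    (Coalgebra.TensorProduct.map (counitCoalgHom k C) (CoalgHom.id k D))

@[simp]
theorem fstHom_tmul (c : C) (d : D) : fstHom k C D (c ⊗ₜ d) = counit (R := k) d • c := rfl

@[simp]
theorem sndHom_tmul (c : C) (d : D) : sndHom k C D (c ⊗ₜ d) = counit (R := k) c • d := rfl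

omit [Coalgebra k C] [Coalgebra k D] in
theorem Conv.ext_tmul {f g : Conv k (C ⊗[k] D) A} (h : ∀ c d, f (c ⊗ₜ d) = g (c ⊗ₜ d)) : f = g :=
  WithConv.ext (TensorProduct.ext' h)

theorem convMul_tmul (f g : Conv k (C ⊗[k] D) A) (c : C) (d : D) :
    (f * g) (c ⊗ₜ d) = ∑ i ∈ (ℛ k c).index, ∑ j ∈ (ℛ k d).index,
      f ((ℛ k c).left i ⊗ₜ (ℛ k d).left j) * g ((ℛ k c).right i ⊗ₜ (ℛ k d).right j) := by
  rw [LinearMap.convMul_apply, TensorProduct.comul_tmul, ← (ℛ k c).eq, ← (ℛ k d).eq]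
  simp only [sum_tmul, tmul_sum, map_sum, AlgebraTensorModule.tensorTensorTensorComm_tmul,
    TensorProduct.map_tmul, LinearMap.mul'_apply]
  exact Finset.sum_comm

theorem sum_counit_smul_left {c : C} {ι : Type*} (r : Coalgebra.Repr k c ι) :
    ∑ i ∈ r.index, counit (R := k) (r.right i) • r.left i = c := by
  have h := congr(TensorProduct.rid k C $(sum_tmul_counit_eq r))
  simpa only [map_sum, TensorProduct.rid_tmul, one_smul] using h

/-- The counit in the projection absorbs one leg of Δ(d), so d can be frozen and only c is split.
This lemma and its variants translate identities of units over a tensor product back into Sweedler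
sums. -/
theorem convPre_fstHom_mul (f : Conv k C A) (g : Conv k (C ⊗[k] D) A) (c : C) (d : D) :
    (convPre (fstHom k C D) f * g) (c ⊗ₜ d) =
      (f * toConv (g.ofConv ∘ₗ (TensorProduct.mk k C D).flip d)) c := by
  rw [convMul_tmul, (ℛ k c).convMul_apply]
  refine Finset.sum_congr rfl fun i _ => ?_
  have h := congr(g ((ℛ k c).right i ⊗ₜ[k] $(sum_counit_smul (ℛ k d))))
  rw [tmul_sum, map_sum] at h
  simp [← h, Finset.mul_sum]

theorem mul_convPre_fstHom (f : Conv k C A) (g : Conv k (C ⊗[k] D) A) (c : C) (d : D) :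
    (g * convPre (fstHom k C D) f) (c ⊗ₜ d) =
      (toConv (g.ofConv ∘ₗ (TensorProduct.mk k C D).flip d) * f) c := by
  rw [convMul_tmul, (ℛ k c).convMul_apply]
  refine Finset.sum_congr rfl fun i _ => ?_
  have h := congr(g ((ℛ k c).left i ⊗ₜ[k] $(sum_counit_smul_left (ℛ k d))))
  rw [tmul_sum, map_sum] at h
  simp [← h, Finset.sum_mul]

theorem convPre_sndHom_mul (f : Conv k D A) (g : Conv k (C ⊗[k] D) A) (c : C) (d : D) :
    (convPre (sndHom k C D) f * g) (c ⊗ₜ d) =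
      (f * toConv (g.ofConv ∘ₗ TensorProduct.mk k C D c)) d := by
  rw [convMul_tmul, (ℛ k d).convMul_apply, Finset.sum_comm]
  refine Finset.sum_congr rfl fun i _ => ?_
  have h := congr(g ($(sum_counit_smul (ℛ k c)) ⊗ₜ[k] (ℛ k d).right i))
  rw [sum_tmul, map_sum] at h
  simp [← h, Finset.mul_sum, ← smul_tmul']

theorem mul_convPre_sndHom (f : Conv k D A) (g : Conv k (C ⊗[k] D) A) (c : C) (d : D) :
    (g * convPre (sndHom k C D) f) (c ⊗ₜ d) =
      (toConv (g.ofConv ∘ₗ TensorProduct.mk k C D c) * f) d := by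
  rw [convMul_tmul, (ℛ k d).convMul_apply, Finset.sum_comm]
  refine Finset.sum_congr rfl fun i _ => ?_
  have h := congr(g ($(sum_counit_smul_left (ℛ k c)) ⊗ₜ[k] (ℛ k d).left i))
  rw [sum_tmul, map_sum] at h
  simp [← h, Finset.sum_mul, ← smul_tmul']

theorem convPre_fstHom_mul_convPre_sndHom (f : Conv k C A) (g : Conv k D A) (c : C) (d : D) :
    (convPre (fstHom k C D) f * convPre (sndHom k C D) g) (c ⊗ₜ d) = f c * g d := by
  have h := congr(f $(sum_counit_smul_left (ℛ k c)))
  rw [map_sum] at h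
  rw [convPre_fstHom_mul, (ℛ k c).convMul_apply, ← h, Finset.sum_mul]
  simp

theorem convPre_sndHom_mul_convPre_fstHom (f : Conv k C A) (g : Conv k D A) (c : C) (d : D) :
    (convPre (sndHom k C D) g * convPre (fstHom k C D) f) (c ⊗ₜ d) = g d * f c := by
  have h := congr(f $(sum_counit_smul (ℛ k c)))
  rw [map_sum] at h
  rw [mul_convPre_fstHom, (ℛ k c).convMul_apply, ← h, Finset.mul_sum]
  simp

theorem commute_convPre_fstHom_sndHom {f : Conv k C A} {g : Conv k D A}
    (h : ∀ c d, Commute (f c) (g d)) :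
    Commute (convPre (fstHom k C D) f) (convPre (sndHom k C D) g) :=
  Conv.ext_tmul fun c d => by
    rw [convPre_fstHom_mul_convPre_sndHom, convPre_sndHom_mul_convPre_fstHom, (h c d).eq]

end Convolution

/-! ### Convolution units coming from algebra homomorphisms -/

section HopfUnit

variable {k H A : Type*} [Field k] [Ring H] [HopfAlgebra k H] [Ring A] [Algebra k A]

/-- An algebra homomorphism from a Hopf algebra is convolution invertible. -/
def hopfUnit (φ : H →ₐ[k] A) : (Conv k H A)ˣ :=
  Units.map (convPost φ)
    ⟨toConv LinearMap.id, toConv (HopfAlgebra.antipode k), LinearMap.id_mul_antipode,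
      LinearMap.antipode_mul_id⟩

@[simp]
theorem hopfUnit_apply (φ : H →ₐ[k] A) (a : H) : (hopfUnit φ : Conv k H A) a = φ a := rfl

@[simp]
theorem hopfUnit_inv_apply (φ : H →ₐ[k] A) (a : H) :
    ((hopfUnit φ)⁻¹ : (Conv k H A)ˣ).val a = φ (HopfAlgebra.antipode k a) := rfl

end HopfUnit

section Units

variable {k C D H A A' : Type*} [Field k] [AddCommGroup C] [Module k C] [Coalgebra k C]
  [AddCommGroup D] [Module k D] [Coalgebra k D]
  [Ring H] [HopfAlgebra k H] [Ring A] [Algebra k A] [Ring A'] [Algebra k A']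

/-- The convolution invertible map `φ ∘ f`, for a coalgebra homomorphism `f` to a Hopf algebra
and an algebra homomorphism `φ` from it. -/
def convUnit (φ : H →ₐ[k] A) (f : C →ₗc[k] H) : (Conv k C A)ˣ :=
  Units.map (convPre f) (hopfUnit φ)

theorem map_convPre_hopfUnit (φ : H →ₐ[k] A) (f : C →ₗc[k] H) :
    Units.map (convPre f) (hopfUnit φ) = convUnit φ f := rfl

theorem convUnit_val (φ : H →ₐ[k] A) (f : C →ₗc[k] H) :
    (convUnit φ f : Conv k C A) = convPre f (hopfUnit φ : Conv k H A) := rfl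

theorem convUnit_inv_val (φ : H →ₐ[k] A) (f : C →ₗc[k] H) :
    ((convUnit φ f)⁻¹ : (Conv k C A)ˣ).val = convPre f ((hopfUnit φ)⁻¹ : (Conv k H A)ˣ).val := rfl

@[simp]
theorem convUnit_apply (φ : H →ₐ[k] A) (f : C →ₗc[k] H) (c : C) :
    (convUnit φ f : Conv k C A) c = φ (f c) := rfl

@[simp]
theorem convUnit_inv_apply (φ : H →ₐ[k] A) (f : C →ₗc[k] H) (c : C) :
    ((convUnit φ f)⁻¹ : (Conv k C A)ˣ).val c = φ (HopfAlgebra.antipode k (f c)) := rfl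

variable (k H) in
/-- The multiplication as a coalgebra homomorphism. -/
def mulHom : H ⊗[k] H →ₗc[k] H where
  __ := LinearMap.mul' k H
  counit_comp := by
    ext a b
    simp [mul_comm]
  map_comp_comul := by
    refine TensorProduct.ext' fun a b => ?_
    have key : ∀ s t : H ⊗[k] H, TensorProduct.map (LinearMap.mul' k H) (LinearMap.mul' k H)
        (AlgebraTensorModule.tensorTensorTensorComm k k k k H H H H (s ⊗ₜ t)) = s * t := by
      intro s t
      induction s with
      | zero => simp
      | add s₁ s₂ h₁ h₂ => rw [add_tmul, map_add, map_add, h₁, h₂, add_mul]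
      | tmul a b =>
        induction t with
        | zero => simp
        | add t₁ t₂ h₁ h₂ => rw [tmul_add, map_add, map_add, h₁, h₂, mul_add]
        | tmul c d => simp
    exact (key _ _).trans (Bialgebra.comul_mul a b).symm

@[simp]
theorem mulHom_tmul (a b : H) : mulHom k H (a ⊗ₜ b) = a * b := rfl

theorem convUnit_mulHom (φ : H →ₐ[k] A) :
    convUnit φ (mulHom k H) = convUnit φ (fstHom k H H) * convUnit φ (sndHom k H H) :=
  Units.ext <| Conv.ext_tmul fun a b => by
    rw [Units.val_mul, convUnit_val, convUnit_val, convUnit_val,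
      convPre_fstHom_mul_convPre_sndHom]
    simp

end Units

/-! ### The convolution ring acting on vector-valued maps -/

section Action

variable {k C V : Type*} [Field k] [AddCommGroup C] [Module k C] [Coalgebra k C]
  [AddCommGroup V] [Module k V]

/-- The action of the convolution ring of `End V`-valued maps on `V`-valued maps,
`c ↦ f(c₁)(x(c₂))`. -/
def convSmul (f : Conv k C (Module.End k V)) (x : C →ₗ[k] V) : C →ₗ[k] V :=
  TensorProduct.lift (f.ofConv.compl₂ x) ∘ₗ comul

theorem convSmul_apply (f : Conv k C (Module.End k V)) (x : C →ₗ[k] V) (c : C) :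
    convSmul f x c = ∑ i ∈ (ℛ k c).index, f ((ℛ k c).left i) (x ((ℛ k c).right i)) := by
  rw [convSmul, LinearMap.comp_apply]
  conv_lhs => rw [← (ℛ k c).eq]
  rw [map_sum]
  rfl

/-- Coassociativity makes this a module action: both sides are the map `K`, which evaluates
f(x₁)(g(x₂)(x(x₃))), on the two bracketings of the iterated coproduct. -/
theorem mul_convSmul (f g : Conv k C (Module.End k V)) (x : C →ₗ[k] V) :
    convSmul (f * g) x = convSmul f (convSmul g x) := by
  let K : C ⊗[k] (C ⊗[k] C) →ₗ[k] V :=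
    TensorProduct.lift (f.ofConv.compl₂ (TensorProduct.lift (g.ofConv.compl₂ x)))
  have h₁ : TensorProduct.lift ((f * g).ofConv.compl₂ x) =
      K ∘ₗ (TensorProduct.assoc k C C C).toLinearMap ∘ₗ comul.rTensor C := by
    refine TensorProduct.ext' fun p q => ?_
    have key : ∀ t : C ⊗[k] C, LinearMap.mul' k (Module.End k V)
        (TensorProduct.map f.ofConv g.ofConv t) (x q) = K (TensorProduct.assoc k C C C (t ⊗ₜ q)) := by
      intro t
      induction t with
      | zero => simp
      | add s t hs ht => rw [map_add, map_add, LinearMap.add_apply, hs, ht, add_tmul, map_add, map_add]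
      | tmul a b => rfl
    exact key _
  have h₂ : TensorProduct.lift (f.ofConv.compl₂ (convSmul g x)) = K ∘ₗ comul.lTensor C :=
    TensorProduct.ext' fun p q => rfl
  refine LinearMap.ext fun c => ?_
  rw [convSmul, h₁, convSmul, h₂]
  simp only [LinearMap.comp_apply, LinearEquiv.coe_coe, coassoc_apply]

theorem one_convSmul (x : C →ₗ[k] V) : convSmul (1 : Conv k C (Module.End k V)) x = x := by
  refine LinearMap.ext fun c => ?_
  have h := congr(x $(sum_counit_smul (ℛ k c)))
  rw [map_sum] at h
  rw [convSmul_apply, ← h]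
  simp [Module.algebraMap_end_apply]

end Action

/-! ### Matched pairs as operator identities; associativity of the second product -/

section Operators

variable {k H : Type*} [Field k] [Ring H] [HopfAlgebra k H] (P : MatchedPair k H)

namespace MatchedPair

/-- The left action as a coalgebra homomorphism. -/
def leftHom : H ⊗[k] H →ₗc[k] H where
  __ := TensorProduct.lift P.left
  counit_comp := by
    ext a b
    simp [P.counit_left, mul_comm]
  map_comp_comul := TensorProduct.ext' fun a b => (P.comul_left a b).symm

/-- The right action as a coalgebra homomorphism. -/
def rightHom : H ⊗[k] H →ₗc[k] H where
  __ := TensorProduct.lift P.right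
  counit_comp := by
    ext a b
    simp [P.counit_right, mul_comm]
  map_comp_comul := TensorProduct.ext' fun a b => (P.comul_right a b).symm

@[simp]
theorem leftHom_tmul (a b : H) : P.leftHom (a ⊗ₜ b) = P.left a b := rfl

@[simp]
theorem rightHom_tmul (a b : H) : P.rightHom (a ⊗ₜ b) = P.right a b := rfl

/-- The left action as a representation. -/
def leftRep : H →ₐ[k] Module.End k H :=
  AlgHom.ofLinearMap P.left (LinearMap.ext P.one_left)
    fun a b => LinearMap.ext (P.mul_left a b)

@[simp]
theorem leftRep_apply (a b : H) : P.leftRep a b = P.left a b := rfl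

/-- The axiom `braided_comm` is a factorisation of the multiplication in the convolution ring, and
composing with an algebra homomorphism preserves it. -/
theorem convUnit_mulHom_eq {A : Type*} [Ring A] [Algebra k A] (φ : H →ₐ[k] A) :
    convUnit φ (mulHom k H) = convUnit φ P.leftHom * convUnit φ P.rightHom := by
  have h : (toConv (LinearMap.mul' k H) : Conv k (H ⊗[k] H) H) =
      toConv (TensorProduct.lift P.left) * toConv (TensorProduct.lift P.right) :=
    Conv.ext_tmul P.braided_comm
  have h' := congr(convPost φ $h)
  rw [map_mul] at h'
  exact Units.ext h'

/-- Solving the factorisation for the right action lets ↼ be eliminated everywhere. -/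
theorem convUnit_rightHom {A : Type*} [Ring A] [Algebra k A] (φ : H →ₐ[k] A) :
    convUnit φ P.rightHom = (convUnit φ P.leftHom)⁻¹ * convUnit φ (mulHom k H) := by
  rw [P.convUnit_mulHom_eq, inv_mul_cancel_left]

/-- The operators `b ↦ a · b` as a convolution invertible map. -/
def dotUnit : (Conv k H (Module.End k H))ˣ :=
  hopfUnit (Algebra.lmul k H) * (hopfUnit P.leftRep)⁻¹

@[simp]
theorem dotUnit_apply (a b : H) : (P.dotUnit : Conv k H (Module.End k H)) a b = P.dot a b := by
  have key : ∀ t : H ⊗[k] H, LinearMap.mul' k (Module.End k H) (TensorProduct.map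
      (Algebra.lmul k H).toLinearMap (P.leftRep.toLinearMap ∘ₗ HopfAlgebra.antipode k) t) =
      TensorProduct.lift ((LinearMap.mul k (Module.End k H)).compl₁₂
        (LinearMap.mul k H) (P.left ∘ₗ HopfAlgebra.antipode k)) t := by
    intro t
    induction t with
    | zero => simp
    | add s t hs ht => rw [map_add, map_add, map_add, hs, ht]
    | tmul a b => rfl
  exact congr($(key (comul a)) b)

/-- The axiom `left_mul` with its last argument removed, so that it becomes a relation in a group:
L(a) M(b) = M(a ⇀ b) L(a ↼ b). -/
theorem left_convPre_mul :
    convUnit P.leftRep (fstHom k H H) * convUnit (Algebra.lmul k H) (sndHom k H H) =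
      convUnit (Algebra.lmul k H) P.leftHom * convUnit P.leftRep P.rightHom := by
  refine Units.ext (Conv.ext_tmul fun a b => LinearMap.ext fun c => ?_)
  rw [Units.val_mul, convUnit_val, convUnit_val, convPre_fstHom_mul_convPre_sndHom]
  have key : ∀ t : (H ⊗[k] H) ⊗[k] (H ⊗[k] H), LinearMap.mul' k H (TensorProduct.map
      (TensorProduct.lift P.left) (P.left.flip c ∘ₗ TensorProduct.lift P.right) t) =
      LinearMap.mul' k (Module.End k H) (TensorProduct.map
        ((Algebra.lmul k H).toLinearMap ∘ₗ TensorProduct.lift P.left)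
        (P.leftRep.toLinearMap ∘ₗ TensorProduct.lift P.right) t) c := by
    intro t
    induction t with
    | zero => simp
    | add s t hs ht => rw [map_add, map_add, hs, ht, map_add, map_add]; rfl
    | tmul a b => rfl
  exact (P.left_mul a b c).trans (key _)

/-- `a ⇀ (b · c) = (a₁ ⇀ b) · (a₂ ⇀ c)` as an identity of operators. -/
theorem leftRep_mul_dotUnit :
    convUnit P.leftRep (fstHom k H H) * Units.map (convPre (sndHom k H H)) P.dotUnit =
      Units.map (convPre P.leftHom) P.dotUnit * convUnit P.leftRep (fstHom k H H) := by
  have h := P.left_convPre_mul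
  -- Substituting L(a ↼ b) = L(a ⇀ b)⁻¹ L(a) L(b) creates M(a ⇀ b) L(a ⇀ b)⁻¹, which is D(a ⇀ b).
  rw [P.convUnit_rightHom, convUnit_mulHom] at h
  simp only [dotUnit, map_mul, map_inv, map_convPre_hopfUnit]
  rw [← mul_assoc, h]
  group

/-- `D(a b) = D(a₁) D(a₂ ⇀ b)` where `D(a)` is the operator `a · -`. -/
theorem dotUnit_mulHom :
    Units.map (convPre (mulHom k H)) P.dotUnit =
      Units.map (convPre (fstHom k H H)) P.dotUnit *
        Units.map (convPre P.leftHom) P.dotUnit := by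
  have h := P.leftRep_mul_dotUnit
  -- In the form D(a ⇀ b) = L(a) D(b) L(a)⁻¹ the right side becomes M(a) L(a)⁻¹ L(a) M(b) L(b)⁻¹
  -- L(a)⁻¹, which is M(ab) L(ab)⁻¹.
  rw [← mul_inv_eq_iff_eq_mul] at h
  rw [← h]
  simp only [dotUnit, map_mul, map_inv, map_convPre_hopfUnit]
  rw [convUnit_mulHom, convUnit_mulHom]
  group

/-- The map `a ⊗ b ↦ a₁ ⊗ (a₂ ⇀ b)` is onto, hence right cancellable. -/
theorem hom_ext {W : Type*} [AddCommGroup W] [Module k W] {f g : H ⊗[k] H →ₗ[k] W}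
    (h : ∀ a b, ∑ i ∈ (ℛ k a).index, f ((ℛ k a).left i ⊗ₜ P.left ((ℛ k a).right i) b) =
      ∑ i ∈ (ℛ k a).index, g ((ℛ k a).left i ⊗ₜ P.left ((ℛ k a).right i) b)) : f = g := by
  let u : (Conv k H (Module.End k (H ⊗[k] H)))ˣ :=
    hopfUnit ((Module.End.rTensorAlgHom k H H).comp (Algebra.lmul k H))
  let v : (Conv k H (Module.End k (H ⊗[k] H)))ˣ :=
    hopfUnit ((Module.End.lTensorAlgHom k H H).comp P.leftRep)
  refine TensorProduct.ext' fun b c => ?_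
  have hu : ∀ x y z : H, u.val x (y ⊗ₜ[k] z) = (x * y) ⊗ₜ z := fun _ _ _ => rfl
  have hv : ∀ x y z : H, v.val x (y ⊗ₜ[k] z) = y ⊗ₜ P.left x z := fun _ _ _ => rfl
  have hv' : ∀ x y z : H, v⁻¹.val x (y ⊗ₜ[k] z) =
    y ⊗ₜ P.left (HopfAlgebra.antipode k x) z := fun _ _ _ => rfl
  -- Here u v v⁻¹ = u and u(b)(1 ⊗ c) = b ⊗ c, while (u v)(x)(1 ⊗ y) = x₁ ⊗ (x₂ ⇀ y). This exhibits
  -- b ⊗ c as a combination of elements of the image.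
  have hb : b ⊗ₜ[k] c = ∑ i ∈ (ℛ k b).index, (u.val * v.val) ((ℛ k b).left i)
      (1 ⊗ₜ P.left (HopfAlgebra.antipode k ((ℛ k b).right i)) c) := by
    have h₁ : u.val b (1 ⊗ₜ c) = b ⊗ₜ[k] c := by rw [hu, mul_one]
    refine h₁.symm.trans ?_
    conv_lhs => rw [← Units.mul_inv_cancel_right u.val v, (ℛ k b).convMul_apply]
    simp only [LinearMap.sum_apply, Module.End.mul_apply, hv']
  have h₂ : ∀ x y, (u.val * v.val) x (1 ⊗ₜ[k] y) =
      ∑ i ∈ (ℛ k x).index, (ℛ k x).left i ⊗ₜ P.left ((ℛ k x).right i) y := by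
    intro x y
    rw [(ℛ k x).convMul_apply]
    simp only [LinearMap.sum_apply, Module.End.mul_apply, hu, hv, mul_one]
  rw [hb]
  simp only [map_sum, h₂, h]

theorem dotUnit_mul_leftRep : P.dotUnit * hopfUnit P.leftRep = hopfUnit (Algebra.lmul k H) := by
  rw [dotUnit, inv_mul_cancel_right]

theorem dot_left (a b : H) :
    ∑ i ∈ (ℛ k a).index, P.dot ((ℛ k a).left i) (P.left ((ℛ k a).right i) b) = a * b := by
  have h' := congr(Units.val $P.dotUnit_mul_leftRep a b)
  rw [Units.val_mul, (ℛ k a).convMul_apply] at h'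
  simpa using h'

/-- By `hom_ext` it suffices to evaluate at a₁ ⊗ (a₂ ⇀ b), where the product · collapses to ab and
the claim is `dotUnit_mulHom`. This is associativity of · in operator form. -/
theorem dotUnit_comp_dot : toConv ((P.dotUnit.val).ofConv ∘ₗ TensorProduct.lift P.dot) =
    convPre (fstHom k H H) P.dotUnit.val * convPre (sndHom k H H) P.dotUnit.val := by
  refine WithConv.ext (P.hom_ext fun a b => ?_)
  have h := congr(Units.val $P.dotUnit_mulHom (a ⊗ₜ[k] b))
  rw [Units.val_mul, Units.coe_map, Units.coe_map, convPre_fstHom_mul,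
    (ℛ k a).convMul_apply] at h
  simp only [convPre_fstHom_mul_convPre_sndHom]
  refine Eq.trans ?_ h
  simp [← map_sum, dot_left]

theorem dot_assoc (a b c : H) : P.dot (P.dot a b) c = P.dot a (P.dot b c) := by
  have h := congr($P.dotUnit_comp_dot (a ⊗ₜ[k] b) c)
  rw [convPre_fstHom_mul_convPre_sndHom] at h
  simpa using h

theorem one_dot (a : H) : P.dot 1 a = a := by
  simp [dot, Algebra.TensorProduct.one_def, P.one_left]

theorem dot_one (a : H) : P.dot a 1 = a := by
  rw [← P.dotUnit_apply, dotUnit, Units.val_mul, (ℛ k a).convMul_apply]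
  have h := sum_counit_smul_left (ℛ k a)
  simpa [P.left_one] using h

theorem left_dot (a b c : H) : P.left a (P.dot b c) =
    ∑ i ∈ (ℛ k a).index, P.dot (P.left ((ℛ k a).left i) b) (P.left ((ℛ k a).right i) c) := by
  have h := congr(Units.val $P.leftRep_mul_dotUnit (a ⊗ₜ[k] b) c)
  rw [Units.val_mul, Units.val_mul, Units.coe_map, Units.coe_map, convUnit_val,
    convPre_fstHom_mul_convPre_sndHom, mul_convPre_fstHom, (ℛ k a).convMul_apply] at h
  simpa using h

theorem S_eq_convSmul : P.S = convSmul (hopfUnit P.leftRep).val (HopfAlgebra.antipode k) := rfl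

/-- `a₁ · S(a₂) = ε(a) 1` -/
theorem dotUnit_convSmul_S (a : H) :
    convSmul P.dotUnit.val P.S a = counit (R := k) a • (1 : H) := by
  rw [S_eq_convSmul, ← mul_convSmul, ← Units.val_mul, dotUnit_mul_leftRep, convSmul_apply]
  exact HopfAlgebra.sum_mul_antipode_eq_smul _

/-- D is multiplicative for ·, so a₁ · S(a₂) = ε(a) 1 makes D ∘ S a right inverse of D; as D is a
unit, it is the inverse. -/
theorem dotUnit_comp_S :
    toConv (P.dotUnit.val.ofConv ∘ₗ P.S) = (P.dotUnit⁻¹).val := by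
  refine (P.dotUnit.inv_eq_of_mul_eq_one_right (Conv.ext_apply fun a => LinearMap.ext fun c => ?_)).symm
  have h := congr(P.dot $(P.dotUnit_convSmul_S a) c)
  rw [convSmul_apply, map_sum] at h
  rw [(ℛ k a).convMul_apply]
  simpa [dot_assoc, one_dot, Module.algebraMap_end_apply] using h

end MatchedPair

end Operators

/-! ### The antipode of the second product -/

section Operators

variable {k H : Type*} [Field k] [Ring H] [HopfAlgebra k H] (P : MatchedPair k H)

namespace MatchedPair

theorem dotUnit_S_apply (a b : H) : P.dot (P.S a) b = (P.dotUnit⁻¹).val a b := by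
  rw [← P.dotUnit_comp_S, ← P.dotUnit_apply]
  rfl

/-- The left identity is D⁻¹ D = 1 evaluated at 1; the right one was the computation that identified
D ∘ S. -/
theorem isAntipode_S : IsAntipode P.dot 1 (comul (R := k)) (counit (R := k)) P.S where
  left_inv a := by
    have h := congr($(P.dotUnit.inv_mul) a 1)
    rw [(ℛ k a).convMul_apply] at h
    conv_lhs => rw [← (ℛ k a).eq]
    simpa [← dotUnit_S_apply, dot_one, Module.algebraMap_end_apply] using h
  right_inv a := by
    rw [← P.dotUnit_convSmul_S, convSmul_apply]
    conv_lhs => rw [← (ℛ k a).eq]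
    simp

/-- Inverting the D factors in `leftRep_mul_dotUnit` gives D(a ⇀ b)⁻¹ L(a) = L(a) D(b)⁻¹. At the
vector 1, which L(a) scales by ε(a), the inverses of D produce S. -/
theorem S_left (a b : H) : P.S (P.left a b) = P.left a (P.S b) := by
  have h := P.leftRep_mul_dotUnit
  have h' : Units.map (convPre P.leftHom) P.dotUnit⁻¹ * convUnit P.leftRep (fstHom k H H) =
      convUnit P.leftRep (fstHom k H H) * Units.map (convPre (sndHom k H H)) P.dotUnit⁻¹ := by
    rw [map_inv, map_inv, inv_mul_eq_iff_eq_mul, ← mul_assoc, ← h, mul_inv_cancel_right]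
  have h₂ := congr(Units.val $h' (a ⊗ₜ[k] b) 1)
  rw [Units.val_mul, Units.val_mul, Units.coe_map, Units.coe_map, convUnit_val,
    convPre_fstHom_mul_convPre_sndHom, mul_convPre_fstHom, (ℛ k a).convMul_apply] at h₂
  have h₃ := congr(P.S (P.left $(sum_counit_smul_left (ℛ k a)) b))
  simp only [map_sum, map_smul, LinearMap.sum_apply, LinearMap.smul_apply] at h₃
  simp only [LinearMap.sum_apply, Module.End.mul_apply, hopfUnit_apply, leftRep_apply, P.left_one,
    map_smul, ← dotUnit_S_apply, dot_one] at h₂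
  rw [← h₂, ← h₃]
  refine Finset.sum_congr rfl fun i _ => ?_
  simp [← dotUnit_S_apply, dot_one]

/-- `S(a₁) · (a₂ b) = a ⇀ b` -/
theorem convMul_dotUnit_inv : P.dotUnit⁻¹ * hopfUnit (Algebra.lmul k H) = hopfUnit P.leftRep := by
  rw [← dotUnit_mul_leftRep, inv_mul_cancel_left]

/-- The relation D⁻¹ M = L with D⁻¹ = D ∘ S. It is what converts the action ⇀ into S and · in the
explicit formulas. -/
theorem sum_dot_S_mul (a b : H) :
    TensorProduct.lift ((LinearMap.mul k (Module.End k H)).compl₁₂ (P.dot ∘ₗ P.S)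
      (LinearMap.mul k H)) (comul a) b = P.left a b := by
  have h := congr(Units.val $P.convMul_dotUnit_inv a b)
  rw [Units.val_mul, (ℛ k a).convMul_apply] at h
  conv_lhs => rw [← (ℛ k a).eq]
  simpa [← dotUnit_S_apply] using h

/-- `T(a₁) ⇀ S(a₂) = T(a)` -/
theorem left_antipode_convSmul_S :
    convSmul ((hopfUnit P.leftRep)⁻¹).val P.S = HopfAlgebra.antipode k := by
  rw [S_eq_convSmul, ← mul_convSmul, Units.inv_mul, one_convSmul]

/-! ### The Yetter–Drinfeld condition -/

end MatchedPair

variable (k H) in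
/-- The left adjoint coaction is the conjugation of the second leg by the first one. -/
theorem adjointCoaction_eq : (toConv (adjointCoaction k H) : Conv k H (H ⊗[k] H)) =
    (hopfUnit Algebra.TensorProduct.includeLeft).val *
      (hopfUnit Algebra.TensorProduct.includeRight).val *
      ((hopfUnit Algebra.TensorProduct.includeLeft)⁻¹).val := by
  refine Conv.ext_apply fun a => ?_
  let K : H ⊗[k] (H ⊗[k] H) →ₗ[k] H ⊗[k] H :=
    (LinearMap.mul' k H ∘ₗ (HopfAlgebra.antipode k).lTensor H).rTensor H ∘ₗ
    (TensorProduct.assoc k H H H).symm.toLinearMap ∘ₗ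
    (TensorProduct.comm k H H).toLinearMap.lTensor H
  rw [mul_assoc, (ℛ k a).convMul_apply]
  simp only [(ℛ k _).convMul_apply]
  change K (comul.lTensor H (comul a)) = _
  conv_lhs => rw [← (ℛ k a).eq]
  simp only [map_sum, LinearMap.lTensor_tmul]
  refine Finset.sum_congr rfl fun i _ => ?_
  conv_lhs => rw [← (ℛ k ((ℛ k a).right i)).eq]
  simp [K, tmul_sum, Finset.mul_sum]

namespace MatchedPair

variable {A : Type*} [Ring A] [Algebra k A]

theorem convUnit_comul {C : Type*} [AddCommGroup C] [Module k C] [Coalgebra k C] (f : C →ₗc[k] H) :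
    convUnit (Bialgebra.comulAlgHom k H) f =
      convUnit Algebra.TensorProduct.includeLeft f *
        convUnit Algebra.TensorProduct.includeRight f := by
  have h : hopfUnit (Bialgebra.comulAlgHom k H) = hopfUnit Algebra.TensorProduct.includeLeft *
      hopfUnit Algebra.TensorProduct.includeRight := by
    refine Units.ext (Conv.ext_apply fun a => ?_)
    rw [Units.val_mul, (ℛ k a).convMul_apply]
    simpa using (ℛ k a).eq.symm
  rw [convUnit, h, map_mul]
  rfl

/-- The compatibility `(a₂ ⇀ b₂) ⊗ (a₁ ↼ b₁) = (a₁ ⇀ b₁) ⊗ (a₂ ↼ b₂)` of a matched pair,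
expressed as a commutation relation. -/
theorem commute_leftHom_rightHom :
    Commute (convUnit (Algebra.TensorProduct.includeRight (R := k) (A := H) (B := H)) P.leftHom)
      (convUnit (Algebra.TensorProduct.includeLeft (R := k) (S := k) (A := H) (B := H))
        P.rightHom) := by
  have h := P.convUnit_mulHom_eq (Bialgebra.comulAlgHom k H)
  have h₁ := P.convUnit_mulHom_eq (Algebra.TensorProduct.includeLeft (R := k) (S := k) (A := H) (B := H))
  have h₂ := P.convUnit_mulHom_eq (Algebra.TensorProduct.includeRight (R := k) (A := H) (B := H))
  -- With Δ = ι₁ ι₂, the element Δ(ab) factors as ι₁(a ⇀ b) ι₁(a ↼ b) ι₂(a ⇀ b) ι₂(a ↼ b), and also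
  -- with the two middle factors exchanged. Cancelling the outer factors leaves the commutation.
  rw [convUnit_comul, convUnit_comul, convUnit_comul, h₁, h₂] at h
  simp only [mul_assoc, mul_right_inj] at h
  simp only [← mul_assoc, mul_left_inj] at h
  exact h.symm

end MatchedPair

end Operators

/-! ### Threefold convolution products -/

section TripleProduct

variable {k H A : Type*} [Field k] [AddCommGroup H] [Module k H] [Coalgebra k H]
  [Ring A] [Algebra k A]

/-- The map `a ⊗ b ⊗ c ↦ f(a) g(b) h(c)`. -/
def mul₃ (f g h : H →ₗ[k] A) : H ⊗[k] (H ⊗[k] H) →ₗ[k] A :=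
  LinearMap.mul' k A ∘ₗ TensorProduct.map f (LinearMap.mul' k A ∘ₗ TensorProduct.map g h)

omit [Coalgebra k H] in
@[simp]
theorem mul₃_tmul (f g h : H →ₗ[k] A) (a b c : H) :
    mul₃ f g h (a ⊗ₜ (b ⊗ₜ c)) = f a * (g b * h c) := rfl

/-- This form allows a threefold convolution to be evaluated on an arbitrary family representing a₁
⊗ a₂ ⊗ a₃, not only on a chosen one. -/
theorem convMul_eq_mul₃ (f g h : Conv k H A) (a : H) :
    (f * (g * h)) a = mul₃ f.ofConv g.ofConv h.ofConv (comul₃ k a) := by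
  have key : ∀ t : H ⊗[k] H, LinearMap.mul' k A (TensorProduct.map f.ofConv (g * h).ofConv t) =
      mul₃ f.ofConv g.ofConv h.ofConv (comul.lTensor H t) := by
    intro t
    induction t with
    | zero => simp
    | add s t hs ht => rw [map_add, map_add, hs, ht, map_add, map_add]
    | tmul a b => rfl
  exact key _

end TripleProduct

/-! ### The adjoint coaction and the Yetter–Drinfeld condition -/

section

variable {k H : Type*} [Field k] [Ring H] [HopfAlgebra k H] (P : MatchedPair k H)

theorem adjointCoaction_apply (a : H) : adjointCoaction k H a =
    mul₃ (Algebra.TensorProduct.includeLeft (R := k) (S := k) (A := H) (B := H)).toLinearMap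
      (Algebra.TensorProduct.includeRight (R := k) (A := H) (B := H)).toLinearMap
      ((Algebra.TensorProduct.includeLeft (R := k) (S := k) (A := H) (B := H)).toLinearMap ∘ₗ
        HopfAlgebra.antipode k) (comul₃ k a) := by
  have h := congr($(adjointCoaction_eq k H) a)
  rw [mul_assoc, convMul_eq_mul₃] at h
  exact h

/-- If `g` is any linear map then `(id ⊗ g) ρ(a) = (a₁ ⊗ 1) (1 ⊗ g(a₂)) (T(a₃) ⊗ 1)`. -/
theorem lTensor_adjointCoaction {A : Type*} [Ring A] [Algebra k A] (g : H →ₗ[k] A) :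
    (toConv (g.lTensor H ∘ₗ adjointCoaction k H) : Conv k H (H ⊗[k] A)) =
      (hopfUnit Algebra.TensorProduct.includeLeft).val *
        toConv (Algebra.TensorProduct.includeRight.toLinearMap ∘ₗ g) *
        ((hopfUnit Algebra.TensorProduct.includeLeft)⁻¹).val := by
  refine Conv.ext_apply fun a => ?_
  rw [mul_assoc, convMul_eq_mul₃, ofConv_toConv, LinearMap.comp_apply, adjointCoaction_apply,
    ← LinearMap.comp_apply]
  congr 1
  ext a b c
  simp [hopfUnit]

theorem hopfUnit_comp_comul {A : Type*} [Ring A] [Algebra k A] (φ : H ⊗[k] H →ₐ[k] A) :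
    hopfUnit (φ.comp (Bialgebra.comulAlgHom k H)) =
      hopfUnit (φ.comp Algebra.TensorProduct.includeLeft) *
        hopfUnit (φ.comp Algebra.TensorProduct.includeRight) := by
  refine Units.ext (Conv.ext_apply fun a => ?_)
  rw [Units.val_mul, (ℛ k a).convMul_apply]
  simpa [← map_mul] using congr(φ $((ℛ k a).eq.symm))

theorem map_convPost_hopfUnit {A B : Type*} [Ring A] [Algebra k A] [Ring B] [Algebra k B]
    (φ : H →ₐ[k] A) (ψ : A →ₐ[k] B) :
    Units.map (convPost ψ) (hopfUnit φ) = hopfUnit (ψ.comp φ) := rfl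

variable (k H) in
/-- The left adjoint coaction as a convolution invertible map. -/
def adjointUnit : (Conv k H (H ⊗[k] H))ˣ :=
  hopfUnit Algebra.TensorProduct.includeLeft * hopfUnit Algebra.TensorProduct.includeRight *
    (hopfUnit Algebra.TensorProduct.includeLeft)⁻¹

variable (k H) in
theorem toConv_adjointCoaction : toConv (adjointCoaction k H) = (adjointUnit k H).val :=
  adjointCoaction_eq k H

-- Let ι₁, ι₂, ι₃ be the three inclusions into H ⊗ H ⊗ H. Applying Δ to the first leg replaces the
-- conjugating element by ι₁ ι₂, while applying ρ to the second leg nests two conjugations. Both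
-- give ι₁ ι₂ ι₃ ι₂⁻¹ ι₁⁻¹.
variable (k H) in
theorem adjointCoaction_coassoc :
    TensorProduct.assoc k H H H ∘ₗ comul.rTensor H ∘ₗ adjointCoaction k H =
      (adjointCoaction k H).lTensor H ∘ₗ adjointCoaction k H := by
  let φ : H ⊗[k] H →ₐ[k] H ⊗[k] (H ⊗[k] H) :=
    (Algebra.TensorProduct.assoc k k k H H H).toAlgHom.comp
      (Algebra.TensorProduct.map (Bialgebra.comulAlgHom k H) (AlgHom.id k H))
  let ψ : H ⊗[k] H →ₐ[k] H ⊗[k] (H ⊗[k] H) :=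
    Algebra.TensorProduct.map (AlgHom.id k H) Algebra.TensorProduct.includeLeft
  have h₁ : φ.comp Algebra.TensorProduct.includeLeft = ψ.comp (Bialgebra.comulAlgHom k H) := by
    refine AlgHom.ext fun a => ?_
    have key : ∀ t : H ⊗[k] H, Algebra.TensorProduct.assoc k k k H H H (t ⊗ₜ 1) = ψ t := by
      intro t
      induction t with
      | zero => simp
      | add s t hs ht => rw [add_tmul, map_add, map_add, hs, ht]
      | tmul a b => rfl
    exact key _
  have h₂ : φ.comp Algebra.TensorProduct.includeRight =
      (Algebra.TensorProduct.includeRight).comp Algebra.TensorProduct.includeRight := by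
    refine AlgHom.ext fun a => ?_
    simp [φ, Algebra.TensorProduct.one_def]
  refine WithConv.toConv_injective ?_
  rw [lTensor_adjointCoaction]
  change convPost φ (toConv (adjointCoaction k H)) = _ *
    convPost Algebra.TensorProduct.includeRight (toConv (adjointCoaction k H)) * _
  rw [toConv_adjointCoaction, ← Units.coe_map, ← Units.coe_map, ← Units.val_mul, ← Units.val_mul,
    Units.val_inj]
  simp only [adjointUnit, map_mul, map_inv, map_convPost_hopfUnit]
  rw [h₁, h₂, hopfUnit_comp_comul]
  have h₃ : ψ.comp Algebra.TensorProduct.includeLeft = Algebra.TensorProduct.includeLeft :=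
    AlgHom.ext fun a => by simp [ψ, Algebra.TensorProduct.one_def]
  have h₄ : ψ.comp Algebra.TensorProduct.includeRight =
      (Algebra.TensorProduct.includeRight).comp Algebra.TensorProduct.includeLeft :=
    AlgHom.ext fun a => by simp [ψ]
  rw [h₃, h₄]
  group

namespace MatchedPair

/-- `ρ(a ⇀ x) = a₁ x₁ T(x₃) T(a₃) ⊗ (a₂ ⇀ x₂)` -/
theorem convPre_leftHom_adjointCoaction :
    convPre P.leftHom (toConv (adjointCoaction k H)) =
      (convUnit Algebra.TensorProduct.includeLeft (mulHom k H)).val *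
        (convUnit Algebra.TensorProduct.includeRight P.leftHom).val *
        ((convUnit Algebra.TensorProduct.includeLeft (mulHom k H))⁻¹).val := by
  rw [adjointCoaction_eq, ← Units.val_mul, ← Units.val_mul, ← Units.val_mul, ← Units.val_mul,
    ← Units.coe_map, Units.val_inj, P.convUnit_mulHom_eq]
  simp only [map_mul, map_inv, map_convPre_hopfUnit]
  -- Since ι₁(ax) = ι₁(a ⇀ x) ι₁(a ↼ x) and the second factor commutes with ι₂(a ⇀ x), conjugating
  -- by ι₁(ax) or by ι₁(a ⇀ x) gives the same result.
  have h := P.commute_leftHom_rightHom.eq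
  rw [mul_inv_rev, mul_assoc _ _ (convUnit _ P.leftHom), mul_assoc, mul_assoc, ← mul_assoc (_ * _),
    ← h]
  group

theorem adjointCoaction_left (a x : H) {ι : Type*} [Fintype ι] (a₁ a₂ a₃ : ι → H)
    (ha : comul₃ k a = ∑ i, a₁ i ⊗ₜ[k] (a₂ i ⊗ₜ[k] a₃ i)) :
    adjointCoaction k H (P.left a x) = ∑ i, TensorProduct.map
      (LinearMap.mulLeft k (a₁ i) ∘ₗ LinearMap.mulRight k (HopfAlgebra.antipode k (a₃ i)))
      (P.left (a₂ i)) (adjointCoaction k H x) := by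
  have h := congr($P.convPre_leftHom_adjointCoaction (a ⊗ₜ[k] x))
  -- With ι₁(ax) = ι₁(a) ι₁(x), the outer conjugation supplies a₁ and T(a₃). The inner one rebuilds
  -- ρ(x) with a₂ ⇀ - applied to its second leg.
  have e : (convUnit Algebra.TensorProduct.includeLeft (mulHom k H)).val *
        (convUnit Algebra.TensorProduct.includeRight P.leftHom).val *
        ((convUnit Algebra.TensorProduct.includeLeft (mulHom k H))⁻¹).val =
      convPre (fstHom k H H) (hopfUnit Algebra.TensorProduct.includeLeft).val *
      ((convPre (sndHom k H H) (hopfUnit Algebra.TensorProduct.includeLeft).val *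
        ((convUnit Algebra.TensorProduct.includeRight P.leftHom).val *
        convPre (sndHom k H H) ((hopfUnit Algebra.TensorProduct.includeLeft)⁻¹).val)) *
      convPre (fstHom k H H) ((hopfUnit Algebra.TensorProduct.includeLeft)⁻¹).val :
        Conv k (H ⊗[k] H) (H ⊗[k] H)) := by
    rw [convUnit_mulHom, mul_inv_rev]
    simp only [Units.val_mul, mul_assoc]
    rfl
  rw [e, convPre_fstHom_mul] at h
  have e₂ : ∀ (f : Conv k (H ⊗[k] H) (H ⊗[k] H)) (g : Conv k H (H ⊗[k] H)),
      toConv ((f * convPre (fstHom k H H) g).ofConv ∘ₗ (TensorProduct.mk k H H).flip x) =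
      toConv (f.ofConv ∘ₗ (TensorProduct.mk k H H).flip x) * g :=
    fun f g => Conv.ext_apply fun c => mul_convPre_fstHom g f c x
  rw [e₂, convMul_eq_mul₃, ha, map_sum] at h
  refine h.trans (Finset.sum_congr rfl fun i _ => ?_)
  rw [mul₃_tmul, ofConv_toConv, LinearMap.comp_apply, LinearMap.flip_apply, TensorProduct.mk_apply,
    convPre_sndHom_mul]
  have e₃ : ∀ (q : H) (f : Conv k (H ⊗[k] H) (H ⊗[k] H)) (g : Conv k H (H ⊗[k] H)),
      toConv ((f * convPre (sndHom k H H) g).ofConv ∘ₗ TensorProduct.mk k H H q) =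
      toConv (f.ofConv ∘ₗ TensorProduct.mk k H H q) * g :=
    fun q f g => Conv.ext_apply fun c => mul_convPre_sndHom g f q c
  have h₂ := congr($(lTensor_adjointCoaction (P.left (a₂ i))) x)
  rw [mul_assoc] at h₂
  rw [e₃]
  refine Eq.trans congr(_ * ($(h₂.symm) * _)) ?_
  change _ * ((P.left (a₂ i)).lTensor H (adjointCoaction k H x) * _) = _
  induction adjointCoaction k H x with
  | zero => simp
  | add s t hs ht => simp only [map_add, add_mul, mul_add, hs, ht]
  | tmul b c => simp [← mul_assoc]

end MatchedPair

end

/-- The inclusion `a ↦ a ⊗ 1`. -/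
abbrev inl (k A B : Type*) [Field k] [Ring A] [Algebra k A] [Ring B] [Algebra k B] :
    A →ₐ[k] A ⊗[k] B := Algebra.TensorProduct.includeLeft

/-- The inclusion `b ↦ 1 ⊗ b`. -/
abbrev inr (k A B : Type*) [Field k] [Ring A] [Algebra k A] [Ring B] [Algebra k B] :
    B →ₐ[k] A ⊗[k] B := Algebra.TensorProduct.includeRight

/-- The group identity behind multiplicativity of the coaction. In its use a, b, x, y are the
first-leg values of a, b, a ⇀ b, a ↼ b, and c, z are D(a), D(a ⇀ b) on the second leg. -/
theorem conj_mul_conj {G : Type*} [Group G] {a b c x y z : G} (h : a * b = x * y)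
    (hz : Commute z y) (hc : Commute c b) :
    a * b * (c * z) * (a * b)⁻¹ = a * c * a⁻¹ * (x * z * x⁻¹) := by
  have e : x * z * x⁻¹ = a * b * z * (a * b)⁻¹ := by
    rw [h, mul_inv_rev, mul_assoc x y z, ← hz.eq]
    group
  rw [e, ← mul_assoc (a * b), mul_assoc a b c, ← hc.eq]
  group

/-! ### Colinearity of the second product -/

section

variable {k H : Type*} [Field k] [Ring H] [HopfAlgebra k H] (P : MatchedPair k H)

namespace MatchedPair

/-- D is a word in M and L, which come from algebra homomorphisms φ; the commutation relation is
transported along id ⊗ φ for each of them. -/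
theorem commute_dotUnit_leftHom_rightHom :
    Commute (Units.map (convPre P.leftHom) (Units.map (convPost
        (inr k H (Module.End k H))) P.dotUnit))
      (convUnit (inl k H (Module.End k H)) P.rightHom) := by
  have key : ∀ φ : H →ₐ[k] Module.End k H,
      Commute (convUnit ((inr k H (Module.End k H)).comp φ) P.leftHom)
        (convUnit (inl k H (Module.End k H)) P.rightHom) := by
    intro φ
    have h := P.commute_leftHom_rightHom.map
      (Units.map (convPost (Algebra.TensorProduct.map (AlgHom.id k H) φ)))
    have e : (Algebra.TensorProduct.map (AlgHom.id k H) φ).comp (inl k H H) =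
        inl k H (Module.End k H) := AlgHom.ext fun a => by simp
    rw [← e]
    exact h
  simp only [dotUnit, map_mul, map_inv, map_convPost_hopfUnit, map_convPre_hopfUnit]
  exact (key _).mul_left (key _).inv_left

/-- `(id ⊗ D) ρ`, where `D(a)` is the operator `a · -`. -/
def dotCoactUnit : (Conv k H (H ⊗[k] Module.End k H))ˣ :=
  hopfUnit (inl k H (Module.End k H)) *
    Units.map (convPost (inr k H (Module.End k H))) P.dotUnit *
    (hopfUnit (inl k H (Module.End k H)))⁻¹

theorem dotCoactUnit_val : P.dotCoactUnit.val =
    toConv (P.dotUnit.val.ofConv.lTensor H ∘ₗ adjointCoaction k H) := by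
  rw [lTensor_adjointCoaction]
  rfl

theorem dotCoactUnit_mulHom : Units.map (convPre (mulHom k H)) P.dotCoactUnit =
    Units.map (convPre (fstHom k H H)) P.dotCoactUnit *
      Units.map (convPre P.leftHom) P.dotCoactUnit := by
  have h₂ : Units.map (convPre (mulHom k H)) (Units.map (convPost
      (inr k H (Module.End k H))) P.dotUnit) =
      Units.map (convPre (fstHom k H H)) (Units.map (convPost
        (inr k H (Module.End k H))) P.dotUnit) *
      Units.map (convPre P.leftHom) (Units.map (convPost
        (inr k H (Module.End k H))) P.dotUnit) := by
    have h := congr(Units.map (convPost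
      (inr k H (Module.End k H)))
      $P.dotUnit_mulHom)
    rw [map_mul] at h
    exact h
  have h₃ : Commute (Units.map (convPre (fstHom k H H)) (Units.map (convPost
        (inr k H (Module.End k H))) P.dotUnit))
      (convUnit (inl k H (Module.End k H)) (sndHom k H H)) :=
    Units.ext (commute_convPre_fstHom_sndHom fun c d => by
      simp [Commute, SemiconjBy])
  have h₄ : convUnit (inl k H (Module.End k H)) (fstHom k H H) * convUnit (inl k H (Module.End k H)) (sndHom k H H) =
      convUnit (inl k H (Module.End k H)) P.leftHom *
        convUnit (inl k H (Module.End k H)) P.rightHom := by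
    rw [← convUnit_mulHom, P.convUnit_mulHom_eq]
  simp only [dotCoactUnit, map_mul, map_inv, map_convPre_hopfUnit, h₂, convUnit_mulHom]
  exact conj_mul_conj h₄ P.commute_dotUnit_leftHom_rightHom h₃

/-- The cancellation argument of `dotUnit_comp_dot`, applied to (id ⊗ D) ρ in place of D. -/
theorem dotCoactUnit_comp_dot :
    toConv (P.dotCoactUnit.val.ofConv ∘ₗ TensorProduct.lift P.dot) =
      convPre (fstHom k H H) P.dotCoactUnit.val * convPre (sndHom k H H) P.dotCoactUnit.val := by
  refine WithConv.ext (P.hom_ext fun a b => ?_)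
  have h := congr(Units.val $P.dotCoactUnit_mulHom (a ⊗ₜ[k] b))
  rw [Units.val_mul, Units.coe_map, Units.coe_map, convPre_fstHom_mul,
    (ℛ k a).convMul_apply] at h
  simp only [convPre_fstHom_mul_convPre_sndHom]
  refine Eq.trans ?_ h
  simp [← map_sum, dot_left]

theorem adjointCoaction_dot : adjointCoaction k H ∘ₗ TensorProduct.lift P.dot =
    (TensorProduct.lift P.dot).lTensor H ∘ₗ
      coactTensor (adjointCoaction k H) (adjointCoaction k H) := by
  refine TensorProduct.ext' fun b c => ?_
  -- Evaluation at 1 undoes D, because a · 1 = a. Multiplicativity of (id ⊗ D) ρ therefore descends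
  -- to ρ itself.
  let ev : Module.End k H →ₗ[k] H := LinearMap.applyₗ 1
  have hev : ∀ t : H ⊗[k] H, ev.lTensor H (P.dotUnit.val.ofConv.lTensor H t) = t := by
    intro t
    induction t with
    | zero => simp
    | add s t hs ht => rw [map_add, map_add, hs, ht]
    | tmul a b => simp [ev, dot_one]
  have hmul : ∀ s t : H ⊗[k] H, ev.lTensor H (P.dotUnit.val.ofConv.lTensor H s *
      P.dotUnit.val.ofConv.lTensor H t) = (TensorProduct.lift P.dot).lTensor H
        ((LinearMap.mul' k H).rTensor (H ⊗[k] H)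
          (TensorProduct.tensorTensorTensorComm k H H H H (s ⊗ₜ t))) := by
    intro s t
    induction s with
    | zero => simp
    | add s₁ s₂ h₁ h₂ => simp only [map_add, add_mul, add_tmul, h₁, h₂]
    | tmul a b =>
      induction t with
      | zero => simp
      | add t₁ t₂ h₁ h₂ => simp only [map_add, mul_add, tmul_add, h₁, h₂]
      | tmul c d => simp [ev, dot_one]
  have h' := congr(ev.lTensor H ($P.dotCoactUnit_comp_dot (b ⊗ₜ[k] c)))
  rw [convPre_fstHom_mul_convPre_sndHom, dotCoactUnit_val] at h'
  exact (hev _).symm.trans (h'.trans (hmul _ _))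

end MatchedPair

end

/-! ### Braided comultiplicativity and the Yetter–Drinfeld Hopf algebra -/

section

variable {k H : Type*} [Field k] [Ring H] [HopfAlgebra k H] (P : MatchedPair k H)

namespace MatchedPair

/-- The operator `(a ⇀ -) ⊗ (b · -)` on `H ⊗ H`. -/
def leftDot : H ⊗[k] H →ₗ[k] Module.End k (H ⊗[k] H) :=
  TensorProduct.lift ((TensorProduct.mapBilinear (RingHom.id k) H H H H).compl₁₂ P.left P.dot)

@[simp]
theorem leftDot_tmul (a b : H) : P.leftDot (a ⊗ₜ b) = TensorProduct.map (P.left a) (P.dot b) := rfl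

/-- The operators `a ⇀ -` on the first factor of `H ⊗ H`. -/
def leftUnit₁ : (Conv k H (Module.End k (H ⊗[k] H)))ˣ :=
  hopfUnit ((Module.End.rTensorAlgHom k H H).comp P.leftRep)

/-- The operators `a · -` on the first factor of `H ⊗ H`. -/
def dotUnit₁ : (Conv k H (Module.End k (H ⊗[k] H)))ˣ :=
  Units.map (convPost (Module.End.rTensorAlgHom k H H)) P.dotUnit

/-- The operators `a · -` on the second factor of `H ⊗ H`. -/
def dotUnit₂ : (Conv k H (Module.End k (H ⊗[k] H)))ˣ :=
  Units.map (convPost (Module.End.lTensorAlgHom k H H)) P.dotUnit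

/-- The coaction leg a₁ T(a₃) acts on the first factor as L(a₁) L(T(a₃)) and a₂ acts on the second
by D, which makes the operator a conjugate. By `braidedMul_tmul` it is the part of the braided
product that contains the braiding. -/
theorem leftDot_adjointCoaction (a : H) : P.leftDot (adjointCoaction k H a) =
    (P.leftUnit₁.val * P.dotUnit₂.val * P.leftUnit₁⁻¹.val) a := by
  rw [mul_assoc, convMul_eq_mul₃, adjointCoaction_apply, ← LinearMap.comp_apply]
  congr 1
  refine TensorProduct.ext' fun a t => ?_
  induction t with
  | zero => simp
  | add s t hs ht => rw [tmul_add, map_add, map_add, hs, ht]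
  | tmul b c =>
  refine TensorProduct.ext' fun x y => ?_
  have h₁ : ∀ a x y : H, P.leftUnit₁.val a (x ⊗ₜ[k] y) = P.left a x ⊗ₜ y := fun _ _ _ => rfl
  have h₂ : ∀ a x y : H, P.dotUnit₂.val a (x ⊗ₜ[k] y) = x ⊗ₜ P.dot a y := fun a x y =>
    congr(x ⊗ₜ[k] $(P.dotUnit_apply a y))
  have h₃ : ∀ a x y : H, P.leftUnit₁⁻¹.val a (x ⊗ₜ[k] y) =
    P.left (HopfAlgebra.antipode k a) x ⊗ₜ y := fun _ _ _ => rfl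
  simp [h₁, h₂, h₃, P.mul_left]

theorem braidedMul_tmul (a b : H) (t : H ⊗[k] H) :
    braidedMul (braiding P.left (adjointCoaction k H)) P.dot ((a ⊗ₜ b) ⊗ₜ t) =
      P.dotUnit₁.val a (P.leftDot (adjointCoaction k H b) t) := by
  have h₁ : ∀ a x y : H, P.dotUnit₁.val a (x ⊗ₜ[k] y) = P.dot a x ⊗ₜ y := fun a x y =>
    congr($(P.dotUnit_apply a x) ⊗ₜ[k] y)
  induction t with
  | zero => simp
  | add s t hs ht => simp only [tmul_add, map_add, hs, ht]
  | tmul c d =>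
    simp only [braidedMul, braiding, LinearMap.comp_apply, LinearEquiv.coe_coe,
      TensorProduct.assoc_tmul, LinearMap.lTensor_tmul, TensorProduct.assoc_symm_tmul,
      LinearMap.rTensor_tmul]
    induction adjointCoaction k H b with
    | zero => simp
    | add s t hs ht => simp only [tmul_add, add_tmul, map_add, hs, ht, LinearMap.add_apply]
    | tmul u v => simp [h₁]

/-- Multiplicativity of Δ and `comul_left` let M and L act on Δ(b) as M₁ M₂ and L₁ L₂. Then M₁ M₂
(L₁ L₂)⁻¹ = M₁ D₂ L₁⁻¹ = D₁ (L₁ D₂ L₁⁻¹). -/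
theorem comul_dot_eq (a b : H) : comul (R := k) (P.dot a b) =
    (P.dotUnit₁.val * (P.leftUnit₁.val * P.dotUnit₂.val * P.leftUnit₁⁻¹.val)) a
      (comul b) := by
  let E (φ : H →ₐ[k] Module.End k H) : H ⊗[k] H →ₐ[k] Module.End k (H ⊗[k] H) :=
    Module.endTensorEndAlgHom.comp (Algebra.TensorProduct.map φ φ)
  have hE (φ : H →ₐ[k] Module.End k H) : hopfUnit ((E φ).comp (Bialgebra.comulAlgHom k H)) =
      hopfUnit ((Module.End.rTensorAlgHom k H H).comp φ) *
        hopfUnit ((Module.End.lTensorAlgHom k H H).comp φ) := by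
    rw [hopfUnit_comp_comul]
    congr 2 <;>
    · refine AlgHom.ext fun a => TensorProduct.ext' fun x y => ?_
      simp [E, Module.endTensorEndAlgHom_apply]
      rfl
  have hM : ∀ s t : H ⊗[k] H, E (Algebra.lmul k H) s t = s * t := by
    intro s t
    induction s with
    | zero => simp
    | add s₁ s₂ h₁ h₂ => rw [map_add, LinearMap.add_apply, h₁, h₂, add_mul]
    | tmul a b =>
      induction t with
      | zero => simp
      | add t₁ t₂ h₁ h₂ => rw [map_add, h₁, h₂, mul_add]
      | tmul c d => simp [E, Module.endTensorEndAlgHom_apply]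
  have hL : ∀ s t : H ⊗[k] H, E P.leftRep s t =
      TensorProduct.map (TensorProduct.lift P.left) (TensorProduct.lift P.left)
        (AlgebraTensorModule.tensorTensorTensorComm k k k k H H H H (s ⊗ₜ t)) := by
    intro s t
    induction s with
    | zero => simp
    | add s₁ s₂ h₁ h₂ => rw [map_add, LinearMap.add_apply, h₁, h₂, add_tmul, map_add, map_add]
    | tmul a b =>
      induction t with
      | zero => simp
      | add t₁ t₂ h₁ h₂ => rw [map_add, h₁, h₂, tmul_add, map_add, map_add]
      | tmul c d => simp [E, Module.endTensorEndAlgHom_apply]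
  have e : P.dotUnit₁ * (P.leftUnit₁ * P.dotUnit₂ * P.leftUnit₁⁻¹) =
      hopfUnit ((E (Algebra.lmul k H)).comp (Bialgebra.comulAlgHom k H)) *
        (hopfUnit ((E P.leftRep).comp (Bialgebra.comulAlgHom k H)))⁻¹ := by
    rw [hE, hE]
    simp only [dotUnit₁, dotUnit₂, leftUnit₁, dotUnit, map_mul, map_inv, map_convPost_hopfUnit]
    group
  simp only [← Units.val_mul]
  rw [e, Units.val_mul, (ℛ k a).convMul_apply, ← P.dotUnit_apply, dotUnit, Units.val_mul,
    (ℛ k a).convMul_apply, LinearMap.sum_apply, LinearMap.sum_apply, map_sum]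
  refine Finset.sum_congr rfl fun i _ => ?_
  refine (Bialgebra.comul_mul _ _).trans ?_
  refine Eq.trans ?_ (hM _ _).symm
  exact congr(_ * $((P.comul_left _ _).trans (hL _ _).symm))

theorem comul_dot (a b : H) : comul (R := k) (P.dot a b) =
    braidedMul (braiding P.left (adjointCoaction k H)) P.dot (comul a ⊗ₜ comul b) := by
  rw [comul_dot_eq, (ℛ k a).convMul_apply]
  conv_rhs => rw [← (ℛ k a).eq]
  simp only [sum_tmul, map_sum, braidedMul_tmul, leftDot_adjointCoaction, LinearMap.sum_apply,
    Module.End.mul_apply]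

theorem _root_.Bosonisation.adjointCoaction_one : adjointCoaction k H 1 = 1 ⊗ₜ 1 := by
  simp [adjointCoaction, comul₃, Algebra.TensorProduct.one_def]

theorem lTensor_eval_dotUnit (t : H ⊗[k] H) : (LinearMap.applyₗ (1 : H)).lTensor H
    (P.dotUnit.val.ofConv.lTensor H t) = t := by
  induction t with
  | zero => simp
  | add s t hs ht => rw [map_add, map_add, hs, ht]
  | tmul a b => simp [dot_one]

/-- After id ⊗ D both sides are the inverse of (id ⊗ D) ρ: the left one because this map is
multiplicative for ·, the right one because D ∘ S = D⁻¹ and inversion commutes with conjugation.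
Evaluation at 1 then removes D. -/
theorem adjointCoaction_S : adjointCoaction k H ∘ₗ P.S =
    P.S.lTensor H ∘ₗ adjointCoaction k H := by
  have h₁ : toConv (P.dotCoactUnit.val.ofConv ∘ₗ P.S) = P.dotCoactUnit⁻¹.val := by
    refine (P.dotCoactUnit.inv_eq_of_mul_eq_one_right (Conv.ext_apply fun a => ?_)).symm
    have h := congr(P.dotCoactUnit.val $(P.dotUnit_convSmul_S a))
    rw [convSmul_apply, map_sum] at h
    rw [(ℛ k a).convMul_apply]
    have h' : ∀ b c, P.dotCoactUnit.val (P.dotUnit.val b c) =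
        P.dotCoactUnit.val b * P.dotCoactUnit.val c := fun b c => by
      rw [← convPre_fstHom_mul_convPre_sndHom, ← P.dotCoactUnit_comp_dot]
      simp
    have h₁ : P.dotCoactUnit.val 1 = 1 := by
      have h₂ : P.dotUnit.val 1 = 1 := LinearMap.ext fun b => by simp [one_dot]
      rw [dotCoactUnit_val, ofConv_toConv, LinearMap.comp_apply, adjointCoaction_one,
        LinearMap.lTensor_tmul, h₂, Algebra.TensorProduct.one_def]
    simp only [h', map_smul, h₁] at h
    exact h.trans (Algebra.algebraMap_eq_smul_one _).symm
  have h₂ : toConv ((P.dotUnit.val.ofConv ∘ₗ P.S).lTensor H ∘ₗ adjointCoaction k H) =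
      P.dotCoactUnit⁻¹.val := by
    rw [lTensor_adjointCoaction]
    have h := P.dotUnit_comp_S
    change _ * convPost (inr k H (Module.End k H)) (toConv (P.dotUnit.val.ofConv ∘ₗ P.S)) * _ = _
    rw [h, ← Units.coe_map, ← Units.val_mul, ← Units.val_mul, Units.val_inj, dotCoactUnit, map_inv]
    group
  refine LinearMap.ext fun a => ?_
  have h := congr((LinearMap.applyₗ (1 : H)).lTensor H ($(h₁.trans h₂.symm) a))
  rw [LinearMap.lTensor_comp] at h
  rw [dotCoactUnit_val] at h
  exact (P.lTensor_eval_dotUnit _).symm.trans (h.trans (P.lTensor_eval_dotUnit _))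

end MatchedPair

-- Δ = ι₁ ι₂ is a product, and conjugation distributes over products.
variable (k H) in
theorem comul_adjointCoaction : comul.lTensor H ∘ₗ adjointCoaction k H =
    coactTensor (adjointCoaction k H) (adjointCoaction k H) ∘ₗ comul := by
  let ψ (φ : H →ₐ[k] H ⊗[k] H) : H ⊗[k] H →ₐ[k] H ⊗[k] (H ⊗[k] H) :=
    Algebra.TensorProduct.map (AlgHom.id k H) φ
  have hψ (φ : H →ₐ[k] H ⊗[k] H) : Units.map (convPost (ψ φ)) (adjointUnit k H) =
      hopfUnit (inl k H (H ⊗[k] H)) * hopfUnit ((inr k H (H ⊗[k] H)).comp φ) *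
        (hopfUnit (inl k H (H ⊗[k] H)))⁻¹ := by
    have h₁ : (ψ φ).comp (inl k H H) = inl k H (H ⊗[k] H) :=
      AlgHom.ext fun a => by simp [ψ]
    have h₂ : (ψ φ).comp (inr k H H) = (inr k H (H ⊗[k] H)).comp φ :=
      AlgHom.ext fun a => by simp [ψ]
    simp only [adjointUnit, map_mul, map_inv, map_convPost_hopfUnit, h₁, h₂]
  have h := hψ (Bialgebra.comulAlgHom k H)
  rw [hopfUnit_comp_comul] at h
  have h' : Units.map (convPost (ψ (Bialgebra.comulAlgHom k H))) (adjointUnit k H) =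
      Units.map (convPost (ψ (inl k H H))) (adjointUnit k H) *
        Units.map (convPost (ψ (inr k H H))) (adjointUnit k H) := by
    rw [h, hψ, hψ]
    group
  refine LinearMap.ext fun a => ?_
  have key : ∀ t : H ⊗[k] H, LinearMap.mul' k (H ⊗[k] (H ⊗[k] H)) (TensorProduct.map
      ((ψ (inl k H H)).toLinearMap ∘ₗ adjointCoaction k H)
      ((ψ (inr k H H)).toLinearMap ∘ₗ adjointCoaction k H) t) =
      coactTensor (adjointCoaction k H) (adjointCoaction k H) t := by
    intro t
    induction t with
    | zero => simp
    | add s t hs ht => rw [map_add, map_add, map_add, hs, ht]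
    | tmul a b =>
      simp only [TensorProduct.map_tmul, LinearMap.comp_apply, LinearMap.mul'_apply, coactTensor,
        LinearEquiv.coe_coe]
      induction adjointCoaction k H a with
      | zero => simp
      | add s₁ s₂ h₁ h₂ => simp only [map_add, add_mul, add_tmul, h₁, h₂]
      | tmul p q =>
        induction adjointCoaction k H b with
        | zero => simp
        | add t₁ t₂ h₁ h₂ => simp only [map_add, mul_add, tmul_add, h₁, h₂]
        | tmul c d => simp [ψ]
  have h'' := congr(Units.val $h' a)
  rw [Units.val_mul, Units.coe_map, Units.coe_map, Units.coe_map, ← toConv_adjointCoaction] at h''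
  exact h''.trans (key _)

theorem hopfUnit_ofId_comp_counit {A : Type*} [Ring A] [Algebra k A] :
    hopfUnit ((Algebra.ofId k A).comp (Bialgebra.counitAlgHom k H)) = 1 :=
  Units.ext rfl

/-- Under ε on the first leg the conjugating unit becomes trivial. In the companion lemma for the
second leg it is the conjugated factor that does. -/
theorem counit_rTensor_adjointCoaction (a : H) :
    (counit (R := k) (A := H)).rTensor H (adjointCoaction k H a) = 1 ⊗ₜ a := by
  let φ : H ⊗[k] H →ₐ[k] k ⊗[k] H :=
    Algebra.TensorProduct.map (Bialgebra.counitAlgHom k H) (AlgHom.id k H)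
  have h₁ : φ.comp (inl k H H) = (Algebra.ofId k _).comp (Bialgebra.counitAlgHom k H) :=
    AlgHom.ext fun a => by simp [φ, Algebra.ofId_apply, Algebra.TensorProduct.algebraMap_apply]
  have h : Units.map (convPost φ) (adjointUnit k H) = hopfUnit (φ.comp (inr k H H)) := by
    simp only [adjointUnit, map_mul, map_inv, map_convPost_hopfUnit, h₁,
      hopfUnit_ofId_comp_counit]
    group
  have h' := congr(Units.val $h a)
  rw [Units.coe_map, ← toConv_adjointCoaction] at h'
  refine Eq.trans h' ?_
  simp [φ]

theorem counit_lTensor_adjointCoaction (a : H) :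
    (counit (R := k) (A := H)).lTensor H (adjointCoaction k H a) =
      1 ⊗ₜ counit (R := k) a := by
  let φ : H ⊗[k] H →ₐ[k] H ⊗[k] k :=
    Algebra.TensorProduct.map (AlgHom.id k H) (Bialgebra.counitAlgHom k H)
  have h₁ : φ.comp (inr k H H) = (Algebra.ofId k _).comp (Bialgebra.counitAlgHom k H) :=
    AlgHom.ext fun a => by
      simp [φ, Algebra.ofId_apply, Algebra.algebraMap_eq_smul_one, Algebra.TensorProduct.one_def,
        ← tmul_smul]
  have h : Units.map (convPost φ) (adjointUnit k H) = 1 := by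
    simp only [adjointUnit, map_mul, map_inv, map_convPost_hopfUnit, h₁,
      hopfUnit_ofId_comp_counit]
    group
  have h' := congr(Units.val $h a)
  rw [Units.coe_map, ← toConv_adjointCoaction] at h'
  refine Eq.trans h' ?_
  simp [Algebra.algebraMap_eq_smul_one, Algebra.TensorProduct.one_def, ← tmul_smul]

namespace MatchedPair

theorem isYetterDrinfeldHopf :
    IsYetterDrinfeldHopf P.left (adjointCoaction k H) P.dot 1 P.S where
  yetterDrinfeld :=
    { one_act := P.one_left
      mul_act := P.mul_left
      counit_coact := counit_rTensor_adjointCoaction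
      coassoc_coact := adjointCoaction_coassoc k H
      coact_act := fun a x _ _ a₁ a₂ a₃ h => P.adjointCoaction_left a x a₁ a₂ a₃ h }
  mul_assoc := P.dot_assoc
  one_mul := P.one_dot
  mul_one := P.dot_one
  act_mul a := TensorProduct.ext' fun b c => by
    have key : ∀ t : H ⊗[k] H, TensorProduct.map₂ P.left P.left t (b ⊗ₜ c) = 
      TensorProduct.map (P.left.flip b) (P.left.flip c) t := by
      intro t
      induction t with
      | zero => simp
      | add s t hs ht => rw [map_add, map_add, LinearMap.add_apply, hs, ht]
      | tmul a b => rfl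
    refine (P.left_dot a b c).trans ?_
    simp only [actTensor, LinearMap.comp_apply, key]
    rw [← (ℛ k a).eq]
    simp
  coact_mul := P.adjointCoaction_dot
  act_one := P.left_one
  coact_one := adjointCoaction_one
  comul_act a := LinearMap.ext fun b => by
    refine (P.comul_left a b).trans ?_
    rw [TensorProduct.comul_tmul]
    simp only [actTensor, LinearMap.comp_apply]
    rw [← (ℛ k a).eq, ← (ℛ k b).eq]
    simp [sum_tmul, tmul_sum]
  comul_coact := comul_adjointCoaction k H
  counit_act := P.counit_left
  counit_coact := counit_lTensor_adjointCoaction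
  comul_mul := P.comul_dot
  comul_one := Bialgebra.comul_one
  counit_mul a b := by
    rw [← P.dotUnit_apply, dotUnit, Units.val_mul, (ℛ k a).convMul_apply]
    have h := congr(counit (R := k) $(sum_counit_smul_left (ℛ k a)))
    rw [map_sum] at h
    rw [← h, Finset.sum_mul]
    simp [P.counit_left, mul_comm, mul_left_comm]
  counit_one := Bialgebra.counit_one
  antipode := P.isAntipode_S
  antipode_act := P.S_left
  antipode_coact := P.adjointCoaction_S

end MatchedPair

end

/-! ### Smash pairs and maps out of a smash product -/

section

variable {k H B A X : Type*} [Field k] [Ring H] [HopfAlgebra k H] [AddCommGroup B] [Module k B]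
  [Ring A] [Algebra k A] [Ring X] [Algebra k X]

/-- Supplies index types in the universe required by the Yetter–Drinfeld condition `coact_act`. -/
theorem exists_sweedler₃ (a : H) : ∃ (ι : Type) (_ : Fintype ι) (a₁ a₂ a₃ : ι → H),
    Sweedler₃ k a a₁ a₂ a₃ := by
  unfold Sweedler₃
  have add : ∀ s t : H ⊗[k] (H ⊗[k] H),
      (∃ (ι : Type) (_ : Fintype ι) (a₁ a₂ a₃ : ι → H),
        s = ∑ i, a₁ i ⊗ₜ[k] (a₂ i ⊗ₜ[k] a₃ i)) →
      (∃ (ι : Type) (_ : Fintype ι) (a₁ a₂ a₃ : ι → H),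
        t = ∑ i, a₁ i ⊗ₜ[k] (a₂ i ⊗ₜ[k] a₃ i)) →
      ∃ (ι : Type) (_ : Fintype ι) (a₁ a₂ a₃ : ι → H),
        s + t = ∑ i, a₁ i ⊗ₜ[k] (a₂ i ⊗ₜ[k] a₃ i) := by
    rintro _ _ ⟨ι, _, a₁, a₂, a₃, rfl⟩ ⟨κ, _, b₁, b₂, b₃, rfl⟩
    exact ⟨ι ⊕ κ, inferInstance, Sum.elim a₁ b₁, Sum.elim a₂ b₂, Sum.elim a₃ b₃, by simp⟩
  have zero : ∃ (ι : Type) (_ : Fintype ι) (a₁ a₂ a₃ : ι → H),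
      (0 : H ⊗[k] (H ⊗[k] H)) = ∑ i, a₁ i ⊗ₜ[k] (a₂ i ⊗ₜ[k] a₃ i) :=
    ⟨Empty, inferInstance, Empty.elim, Empty.elim, Empty.elim, by simp⟩
  induction comul₃ k a with
  | zero => exact zero
  | add s t hs ht => exact add s t hs ht
  | tmul x s =>
    induction s with
    | zero => simpa using zero
    | add s t hs ht => rw [tmul_add]; exact add _ _ hs ht
    | tmul y z => exact ⟨Unit, inferInstance, fun _ => x, fun _ => y, fun _ => z, by simp⟩

/-- A pair of a multiplicative map on `B` and an algebra homomorphism on `H` with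
`ψ(h) φ(b) = φ(h₁ ⇀ b) ψ(h₂)`. -/
structure IsSmashPair (act : H →ₗ[k] B →ₗ[k] B) (mul : B →ₗ[k] B →ₗ[k] B) (one : B)
    (φ : B →ₗ[k] X) (ψ : H →ₐ[k] X) : Prop where
  map_mul : ∀ x y, φ (mul x y) = φ x * φ y
  map_one : φ one = 1
  comm : ∀ h b, ψ h * φ b =
    ∑ x ∈ (ℛ k h).index, φ (act ((ℛ k h).left x) b) * ψ ((ℛ k h).right x)

/-- The map `b ⊗ h ↦ φ(b) ψ(h)`. -/
def smashLift (φ : B →ₗ[k] X) (ψ : H →ₐ[k] X) : B ⊗[k] H →ₗ[k] X :=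
  TensorProduct.lift ((LinearMap.mul k X).compl₁₂ φ ψ.toLinearMap)

@[simp]
theorem smashLift_tmul (φ : B →ₗ[k] X) (ψ : H →ₐ[k] X) (b : B) (h : H) :
    smashLift φ ψ (b ⊗ₜ h) = φ b * ψ h := rfl

theorem smashLift_hom_ext {i : B →ₗ[k] A} {j : H →ₐ[k] A}
    (hs : Function.Surjective (smashLift i j)) {W : Type*} [AddCommGroup W] [Module k W]
    {f g : A →ₗ[k] W} (h : ∀ b a, f (i b * j a) = g (i b * j a)) : f = g := by
  refine LinearMap.ext fun x => ?_
  obtain ⟨t, rfl⟩ := hs x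
  exact congr($(TensorProduct.ext' (g := f ∘ₗ smashLift i j) (h := g ∘ₗ smashLift i j) h) t)

variable {act : H →ₗ[k] B →ₗ[k] B} {mul : B →ₗ[k] B →ₗ[k] B} {one : B}

/-- A smash pair extends to an algebra homomorphism. -/
def IsSmashPair.algHom {i : B →ₗ[k] A} {j : H →ₐ[k] A} (hA : IsSmashPair act mul one i j)
    (hs : Function.Surjective (smashLift i j)) {φ : B →ₗ[k] X} {ψ : H →ₐ[k] X}
    (hX : IsSmashPair act mul one φ ψ) (F : A →ₗ[k] X) (hF : ∀ b h, F (i b * j h) = φ b * ψ h) :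
    A →ₐ[k] X :=
  AlgHom.ofLinearMap F (by
      have h := hF one 1
      rwa [hA.map_one, hX.map_one, _root_.map_one, _root_.map_one, mul_one, mul_one] at h) (by
    -- The relation `comm` moves j(h) past i(c) in A and, identically, ψ(h) past φ(c) in X.
    have h₁ : ∀ b h c g, F ((i b * j h) * (i c * j g)) = F (i b * j h) * F (i c * j g) := by
      intro b h c g
      rw [mul_assoc, ← mul_assoc (j h), hA.comm, hF, hF, mul_assoc, ← mul_assoc (ψ h), hX.comm,
        Finset.sum_mul, Finset.sum_mul, Finset.mul_sum, Finset.mul_sum, map_sum]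
      refine Finset.sum_congr rfl fun x _ => ?_
      rw [mul_assoc, ← _root_.map_mul j, ← mul_assoc, ← hA.map_mul, hF, hX.map_mul, _root_.map_mul ψ]
      simp only [mul_assoc]
    intro x y
    have h₃ : ∀ b h, F ∘ₗ LinearMap.mulLeft k (i b * j h) =
        LinearMap.mulLeft k (F (i b * j h)) ∘ₗ F :=
      fun b h => smashLift_hom_ext hs fun c g => h₁ b h c g
    have h₄ : F ∘ₗ LinearMap.mulRight k y = LinearMap.mulRight k (F y) ∘ₗ F :=
      smashLift_hom_ext hs fun b h => congr($(h₃ b h) y)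
    exact congr($h₄ x))

theorem smashLift_algHom_ext {i : B →ₗ[k] A} {j : H →ₐ[k] A}
    (hs : Function.Surjective (smashLift i j)) {f g : A →ₐ[k] X} (hi : ∀ b, f (i b) = g (i b))
    (hj : ∀ h, f (j h) = g (j h)) : f = g :=
  AlgHom.toLinearMap_injective (smashLift_hom_ext hs fun b h => by simp [hi, hj])

variable [Coalgebra k B]

omit [Coalgebra k B] in
theorem map₂_eq_map_lift (f g : H →ₗ[k] B →ₗ[k] B) (s : H ⊗[k] H) (t : B ⊗[k] B) :
    TensorProduct.map₂ f g s t = TensorProduct.map (TensorProduct.lift f) (TensorProduct.lift g)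
      (AlgebraTensorModule.tensorTensorTensorComm k k k k H H B B (s ⊗ₜ t)) := by
  induction s with
  | zero => simp
  | add s₁ s₂ h₁ h₂ => rw [map_add, LinearMap.add_apply, h₁, h₂, add_tmul, map_add, map_add]
  | tmul a b =>
    induction t with
    | zero => simp
    | add t₁ t₂ h₁ h₂ => rw [map_add, h₁, h₂, tmul_add, map_add, map_add]
    | tmul c d => rfl

/-- An action compatible with the coalgebra structures, as a coalgebra homomorphism. -/
def actHom (act : H →ₗ[k] B →ₗ[k] B)
    (comul_act : ∀ a, comul ∘ₗ act a = actTensor act act a ∘ₗ comul)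
    (counit_act : ∀ a x, counit (R := k) (act a x) = counit (R := k) a * counit (R := k) x) :
    H ⊗[k] B →ₗc[k] B where
  __ := TensorProduct.lift act
  counit_comp := by
    ext a b
    simp [counit_act, mul_comm]
  map_comp_comul := TensorProduct.ext' fun a b =>
    ((LinearMap.congr_fun (comul_act a) b).trans (map₂_eq_map_lift _ _ _ _)).symm

/-- Turns the smash relation into an identity in the convolution ring over H ⊗ B, where products of
maps can be handled factor by factor. -/
theorem convPre_comm_iff {comul_act : ∀ a, comul ∘ₗ act a = actTensor act act a ∘ₗ comul}
    {counit_act : ∀ a x, counit (R := k) (act a x) = counit (R := k) a * counit (R := k) x}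
    (φ : Conv k B X) (ψ : Conv k H X) :
    convPre (fstHom k H B) ψ * convPre (sndHom k H B) φ =
      convPre (actHom act comul_act counit_act) φ * convPre (fstHom k H B) ψ ↔
    ∀ h b, ψ h * φ b =
      ∑ x ∈ (ℛ k h).index, φ (act ((ℛ k h).left x) b) * ψ ((ℛ k h).right x) := by
  have key : ∀ h b, (convPre (actHom act comul_act counit_act) φ * convPre (fstHom k H B) ψ)
      (h ⊗ₜ b) = ∑ x ∈ (ℛ k h).index, φ (act ((ℛ k h).left x) b) * ψ ((ℛ k h).right x) := by
    intro h b
    rw [mul_convPre_fstHom, (ℛ k h).convMul_apply]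
    rfl
  constructor
  · intro e h b
    rw [← key, ← e, convPre_fstHom_mul_convPre_sndHom]
  · intro e
    refine Conv.ext_tmul fun h b => ?_
    rw [key, ← e, convPre_fstHom_mul_convPre_sndHom]

variable {coact : B →ₗ[k] H ⊗[k] B} {S : B →ₗ[k] B}

/-- The map `b ↦ j(b₋₁) ⊗ i(b₀)`. -/
def coactMap (coact : B →ₗ[k] H ⊗[k] B) (i : B →ₗ[k] A) (j : H →ₐ[k] A) : B →ₗ[k] A ⊗[k] A :=
  TensorProduct.map j.toLinearMap i ∘ₗ coact

/-- The map `b ↦ i(b₁) j((b₂)₋₁) ⊗ i((b₂)₀)`. -/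
def comulMap (coact : B →ₗ[k] H ⊗[k] B) (i : B →ₗ[k] A) (j : H →ₐ[k] A) : Conv k B (A ⊗[k] A) :=
  toConv ((inl k A A).toLinearMap ∘ₗ i) * toConv (coactMap coact i j)

/-- The map `h ↦ j(h₁) ⊗ j(h₂)`. -/
def comulHom (j : H →ₐ[k] A) : H →ₐ[k] A ⊗[k] A :=
  (Algebra.TensorProduct.map j j).comp (Bialgebra.comulAlgHom k H)

variable (hB : IsYetterDrinfeldHopf act coact mul one S) {i : B →ₗ[k] A} {j : H →ₐ[k] A}
  (hA : IsSmashPair act mul one i j)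

include hB hA

theorem coactMap_mul (x y : B) :
    coactMap coact i j (mul x y) = coactMap coact i j x * coactMap coact i j y := by
  have h := congr(TensorProduct.map j.toLinearMap i ($hB.coact_mul (x ⊗ₜ y)))
  refine h.trans ?_
  simp only [coactTensor, LinearMap.comp_apply, TensorProduct.map_tmul, coactMap,
    LinearEquiv.coe_coe]
  induction coact x with
  | zero => simp
  | add s t hs ht => simp only [add_tmul, map_add, hs, ht, add_mul]
  | tmul a b =>
    induction coact y with
    | zero => simp
    | add s t hs ht => simp only [tmul_add, map_add, hs, ht, mul_add]
    | tmul c d => simp [hA.map_mul]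

/-- `R(x) E(y) = E(x₋₁ ⇀ y) R(x₀)` for `E(b) = i(b) ⊗ 1` and `R(b) = j(b₋₁) ⊗ i(b₀)`. -/
theorem coactMap_mul_inl (x y : B) : coactMap coact i j x * (i y ⊗ₜ[k] 1) =
    TensorProduct.lift ((LinearMap.mul k (A ⊗[k] A)).compl₁₂ ((inl k A A).toLinearMap ∘ₗ i)
      (coactMap coact i j)) (braiding act coact (x ⊗ₜ y)) := by
  -- `K` sends p ⊗ q ⊗ c to i(p ⇀ y) j(q) ⊗ i(c). The two sides are `K` of the iterated coaction of
  -- x in its two bracketings.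
  let K : H ⊗[k] (H ⊗[k] B) →ₗ[k] A ⊗[k] A :=
    TensorProduct.map (LinearMap.mul' k A) i ∘ₗ
      (TensorProduct.assoc k A A B).symm.toLinearMap ∘ₗ
      TensorProduct.map (i ∘ₗ act.flip y) (j.toLinearMap.rTensor B)
  have h₁ : ∀ t : H ⊗[k] B, TensorProduct.lift ((LinearMap.mul k (A ⊗[k] A)).compl₁₂
      ((inl k A A).toLinearMap ∘ₗ i) (coactMap coact i j))
      ((TensorProduct.lift act).rTensor B (TensorProduct.rightComm k H B B (t ⊗ₜ y))) =
      K (coact.lTensor H t) := by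
    intro t
    induction t with
    | zero => simp
    | add s t hs ht => simp only [add_tmul, map_add, hs, ht]
    | tmul a b =>
      simp only [TensorProduct.rightComm_tmul, LinearMap.rTensor_tmul, TensorProduct.lift.tmul,
        LinearMap.lTensor_tmul, coactMap, LinearMap.compl₁₂_apply, LinearMap.comp_apply]
      induction coact b with
      | zero => simp
      | add s t hs ht => simp only [map_add, tmul_add, hs, ht]
      | tmul c d => simp [K]
  have h₂ : ∀ t : H ⊗[k] B, TensorProduct.map j.toLinearMap i t * (i y ⊗ₜ[k] 1) =
      K (TensorProduct.assoc k H H B (comul.rTensor B t)) := by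
    intro t
    induction t with
    | zero => simp
    | add s t hs ht => simp only [map_add, add_mul, hs, ht]
    | tmul a b =>
      simp only [TensorProduct.map_tmul, AlgHom.toLinearMap_apply,
        Algebra.TensorProduct.tmul_mul_tmul, hA.comm, LinearMap.rTensor_tmul, mul_one]
      conv_rhs => rw [← (ℛ k a).eq]
      simp [K, sum_tmul]
  rw [braiding, LinearMap.comp_apply, LinearMap.comp_apply, LinearMap.rTensor_tmul]
  refine Eq.trans ?_ (h₁ _).symm
  have h₃ := congr($hB.yetterDrinfeld.coassoc_coact x)
  exact (h₂ _).trans congr(K $h₃)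

end

/-- Used with a, b the two legs of j(h₁) ⊗ j(h₂) and x, y the two factors of `comulMap`; z is the
intermediate form of y after b has passed it. -/
theorem mul_mul_mul_comm_of_semiconj {M : Type*} [Monoid M] {a b x y x' y' z : M}
    (h₁ : a * x = x' * a) (h₂ : b * x = x * b) (h₃ : b * y = z * b) (h₄ : y' * a = a * z) :
    a * b * (x * y) = x' * y' * (a * b) :=
  calc a * b * (x * y) = a * (b * x) * y := by simp only [mul_assoc]
    _ = a * x * (b * y) := by rw [h₂]; simp only [mul_assoc]
    _ = x' * (a * z) * b := by rw [h₁, h₃]; simp only [mul_assoc]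
    _ = x' * y' * (a * b) := by rw [← h₄]; simp only [mul_assoc]

/-! ### The comultiplication and the counit as smash pairs -/

section

variable {k H B A X : Type*} [Field k] [Ring H] [HopfAlgebra k H] [AddCommGroup B] [Module k B]
  [Ring A] [Algebra k A] [Ring X] [Algebra k X]
  {act : H →ₗ[k] B →ₗ[k] B} {mul : B →ₗ[k] B →ₗ[k] B} {one : B} [Coalgebra k B]
  {coact : B →ₗ[k] H ⊗[k] B} {S : B →ₗ[k] B}
  (hB : IsYetterDrinfeldHopf act coact mul one S) {i : B →ₗ[k] A} {j : H →ₐ[k] A}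
  (hA : IsSmashPair act mul one i j)

theorem comulMap_apply (b : B) : comulMap coact i j b =
    TensorProduct.lift ((LinearMap.mul k (A ⊗[k] A)).compl₁₂ ((inl k A A).toLinearMap ∘ₗ i)
      (coactMap coact i j)) (comul b) := by
  rw [comulMap, (ℛ k b).convMul_apply]
  conv_rhs => rw [← (ℛ k b).eq]
  simp

include hB hA

/-- With E(b) = i(b) ⊗ 1 and R = `coactMap`, the product E(x₁) R(x₂) E(y₁) R(y₂) is reordered in the
middle by `coactMap_mul_inl`. This produces exactly the braiding in `comul_mul`. -/
theorem comulMap_mul (x y : B) :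
    comulMap coact i j (mul x y) = comulMap coact i j x * comulMap coact i j y := by
  simp only [comulMap_apply, hB.comul_mul]
  generalize hG : TensorProduct.lift ((LinearMap.mul k (A ⊗[k] A)).compl₁₂
    ((inl k A A).toLinearMap ∘ₗ i) (coactMap coact i j)) = G
  have h₁ : ∀ a b, G (a ⊗ₜ b) = (i a ⊗ₜ 1) * coactMap coact i j b := fun a b => by
    rw [← hG]; rfl
  have h₂ : ∀ (p u : B) (w : B ⊗[k] B), G (TensorProduct.map (TensorProduct.lift mul)
      (TensorProduct.lift mul) ((TensorProduct.assoc k B B (B ⊗[k] B)).symm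
        (p ⊗ₜ TensorProduct.assoc k B B B (w ⊗ₜ u)))) =
      (i p ⊗ₜ 1) * G w * coactMap coact i j u := by
    intro p u w
    induction w with
    | zero => simp
    | add s t hs ht => simp only [add_tmul, tmul_add, map_add, hs, ht, mul_add, add_mul]
    | tmul c d =>
      simp only [TensorProduct.assoc_tmul, TensorProduct.assoc_symm_tmul, TensorProduct.map_tmul,
        TensorProduct.lift.tmul, h₁, coactMap_mul hB hA, hA.map_mul]
      rw [← mul_one (1 : A), ← Algebra.TensorProduct.tmul_mul_tmul, mul_one]
      simp only [mul_assoc]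
  generalize comul (R := k) x = s
  generalize comul (R := k) y = t
  induction s with
  | zero => simp
  | add s₁ s₂ e₁ e₂ => simp only [add_tmul, map_add, e₁, e₂, add_mul]
  | tmul p q =>
    induction t with
    | zero => simp
    | add t₁ t₂ e₁ e₂ => simp only [tmul_add, map_add, e₁, e₂, mul_add]
    | tmul r u =>
      have h₃ := coactMap_mul_inl hB hA q r
      rw [hG] at h₃
      simp only [braidedMul, LinearMap.comp_apply, LinearEquiv.coe_coe, TensorProduct.assoc_tmul,
        LinearMap.lTensor_tmul, TensorProduct.assoc_symm_tmul, LinearMap.rTensor_tmul, h₂, ← h₃,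
        h₁, mul_assoc]

theorem comulMap_one : comulMap coact i j one = 1 := by
  rw [comulMap_apply, hB.comul_one]
  simp [coactMap, hB.coact_one, hA.map_one, ← Algebra.TensorProduct.one_def]

-- The Yetter–Drinfeld condition with T(h₃) cleared to the other side: ρ(h₁ ⇀ b) (h₂ ⊗ 1) = h₁ b₋₁ ⊗
-- (h₂ ⇀ b₀), mapped to A ⊗ A.
omit hA in
theorem convPre_actHom_coactMap :
    convPre (actHom act hB.comul_act hB.counit_act) (toConv (coactMap coact i j)) *
      (convUnit ((inl k A A).comp j) (fstHom k H B)).val =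
    (convUnit ((inl k A A).comp j) (fstHom k H B)).val *
      toConv (TensorProduct.lift ((TensorProduct.mapBilinear (RingHom.id k) H B A A
        j.toLinearMap ∘ₗ LinearMap.llcomp k B B A i ∘ₗ act).compl₂ coact)) := by
  rw [← Units.eq_mul_inv_iff_mul_eq]
  refine Conv.ext_tmul fun h b => ?_
  rw [mul_assoc, convUnit_val, convPre_fstHom_mul]
  obtain ⟨ι, _, a₁, a₂, a₃, ha⟩ := exists_sweedler₃ (k := k) h
  have e₂ : ∀ (f : Conv k (H ⊗[k] B) (A ⊗[k] A)) (g : Conv k H (A ⊗[k] A)),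
      toConv ((f * convPre (fstHom k H B) g).ofConv ∘ₗ (TensorProduct.mk k H B).flip b) =
      toConv (f.ofConv ∘ₗ (TensorProduct.mk k H B).flip b) * g :=
    fun f g => Conv.ext_apply fun c => mul_convPre_fstHom g f c b
  rw [convUnit_inv_val, e₂, convMul_eq_mul₃, ha, map_sum]
  have h₁ := congr(TensorProduct.map j.toLinearMap i
    $(hB.yetterDrinfeld.coact_act h b a₁ a₂ a₃ ha))
  rw [map_sum] at h₁
  refine h₁.trans (Finset.sum_congr rfl fun x _ => ?_)
  rw [mul₃_tmul]
  simp only [LinearMap.comp_apply, LinearMap.flip_apply, TensorProduct.mk_apply,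
    TensorProduct.lift.tmul, LinearMap.compl₂_apply]
  induction coact b with
  | zero => simp
  | add s t hs ht => simp only [map_add, add_mul, mul_add, hs, ht]
  | tmul c d => simp

/-- Both maps are products of two factors. The factor i(b) ⊗ 1 only meets j on the first leg. For
the coaction factor, j on the second leg uses the smash relation and j on the first uses the
Yetter–Drinfeld condition. -/
theorem comulMap_comm :
    convPre (fstHom k H B) (hopfUnit (comulHom j)).val *
        convPre (sndHom k H B) (comulMap coact i j) =
      convPre (actHom act hB.comul_act hB.counit_act) (comulMap coact i j) *
        convPre (fstHom k H B) (hopfUnit (comulHom j)).val := by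
  have e₁ : (Algebra.TensorProduct.map j j).comp (inl k H H) = (inl k A A).comp j :=
    AlgHom.ext fun a => by simp
  have e₂ : (Algebra.TensorProduct.map j j).comp (inr k H H) = (inr k A A).comp j :=
    AlgHom.ext fun a => by simp
  have hΨ : hopfUnit (comulHom j) = hopfUnit ((inl k A A).comp j) *
      hopfUnit ((inr k A A).comp j) := by
    rw [comulHom, hopfUnit_comp_comul, e₁, e₂]
  -- `j(h₁) i(b)` on the first factor
  have hE : convPre (fstHom k H B) (hopfUnit ((inl k A A).comp j)).val *
        convPre (sndHom k H B) (toConv ((inl k A A).toLinearMap ∘ₗ i)) =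
      convPre (actHom act hB.comul_act hB.counit_act) (toConv ((inl k A A).toLinearMap ∘ₗ i)) *
        convPre (fstHom k H B) (hopfUnit ((inl k A A).comp j)).val := by
    rw [convPre_comm_iff]
    intro h b
    simp [hA.comm, sum_tmul]
  have hE₂ : Commute (convPre (fstHom k H B) (hopfUnit ((inr k A A).comp j)).val)
        (convPre (sndHom k H B) (toConv ((inl k A A).toLinearMap ∘ₗ i))) :=
    commute_convPre_fstHom_sndHom fun c d => by simp [Commute, SemiconjBy]
  have hR : convPre (fstHom k H B) (hopfUnit ((inr k A A).comp j)).val *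
      convPre (sndHom k H B) (toConv (coactMap coact i j)) =
      toConv (TensorProduct.lift ((TensorProduct.mapBilinear (RingHom.id k) H B A A
        j.toLinearMap ∘ₗ LinearMap.llcomp k B B A i ∘ₗ act).compl₂ coact)) *
        convPre (fstHom k H B) (hopfUnit ((inr k A A).comp j)).val := by
    refine Conv.ext_tmul fun h b => ?_
    rw [convPre_fstHom_mul_convPre_sndHom, mul_convPre_fstHom, (ℛ k h).convMul_apply]
    simp only [LinearMap.comp_apply, LinearMap.flip_apply, TensorProduct.mk_apply,
      TensorProduct.lift.tmul, LinearMap.compl₂_apply, coactMap]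
    induction coact b with
    | zero => simp
    | add s t hs ht => simp only [map_add, mul_add, add_mul, hs, ht, Finset.sum_add_distrib]
    | tmul c d => simp [hA.comm, tmul_sum]
  have hR' := convPre_actHom_coactMap (i := i) (j := j) hB
  rw [convUnit_val] at hR'
  rw [hΨ, comulMap, Units.val_mul, map_mul, map_mul, map_mul]
  exact mul_mul_mul_comm_of_semiconj hE hE₂.eq hR hR'

/-- The comultiplication of the bosonisation comes from a smash pair. -/
theorem isSmashPair_comul :
    IsSmashPair act mul one (comulMap coact i j).ofConv (comulHom j) where
  map_mul := comulMap_mul hB hA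
  map_one := comulMap_one hB hA
  comm := (convPre_comm_iff _ _).1 (comulMap_comm hB hA)

omit hA in
/-- The counit of the bosonisation comes from a smash pair. -/
theorem isSmashPair_counit :
    IsSmashPair act mul one (counit (R := k) (A := B)) (Bialgebra.counitAlgHom k H) where
  map_mul := hB.counit_mul
  map_one := hB.counit_one
  comm h b := by
    have e := congr(counit (R := k) $(sum_counit_smul_left (ℛ k h)))
    rw [map_sum] at e
    simp only [Bialgebra.counitAlgHom_apply, hB.counit_act, ← e, map_smul, smul_eq_mul,
      Finset.sum_mul]
    exact Finset.sum_congr rfl fun x _ => by ring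

end

/-! ### Bialgebra axioms for the bosonisation -/

section

variable {k H B A X : Type*} [Field k] [Ring H] [HopfAlgebra k H] [AddCommGroup B] [Module k B]
  [Ring A] [Algebra k A] [Ring X] [Algebra k X]
  {act : H →ₗ[k] B →ₗ[k] B} {mul : B →ₗ[k] B →ₗ[k] B} {one : B} [Coalgebra k B]
  {coact : B →ₗ[k] H ⊗[k] B} {S : B →ₗ[k] B}
  (hB : IsYetterDrinfeldHopf act coact mul one S) {i : B →ₗ[k] A} {j : H →ₐ[k] A}
  (hA : IsSmashPair act mul one i j)

theorem map₂_mul_mul (s t : A ⊗[k] A) :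
    TensorProduct.map₂ (LinearMap.mul k A) (LinearMap.mul k A) s t = s * t := by
  induction s with
  | zero => simp
  | add s₁ s₂ h₁ h₂ => rw [map_add, LinearMap.add_apply, h₁, h₂, add_mul]
  | tmul a b =>
    induction t with
    | zero => simp
    | add t₁ t₂ h₁ h₂ => rw [map_add, h₁, h₂, mul_add]
    | tmul c d => simp

include hB

/-- Coassociativity on i(b). With E and R the factors of `comulMap`, both sides equal χ(E) χ(R) X₃:
on the left R becomes X₃ by coassociativity of the coaction, and on the right R becomes χ(R) X₃ by
colinearity of Δ. -/
theorem convPost_comulMap (D : A →ₐ[k] A ⊗[k] A) (hi : ∀ b, D (i b) = comulMap coact i j b)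
    (hj : ∀ h, D (j h) = comulHom j h) :
    convPost ((Algebra.TensorProduct.assoc k k k A A A).toAlgHom.comp
        (Algebra.TensorProduct.map D (AlgHom.id k A))) (comulMap coact i j) =
      convPost (Algebra.TensorProduct.map (AlgHom.id k A) D) (comulMap coact i j) := by
  let χ : A ⊗[k] A →ₐ[k] A ⊗[k] (A ⊗[k] A) :=
    Algebra.TensorProduct.map (AlgHom.id k A) (inl k A A)
  let X₃ : B →ₗ[k] A ⊗[k] (A ⊗[k] A) := TensorProduct.map j.toLinearMap (coactMap coact i j) ∘ₗ coact
  have e₁ : convPost ((Algebra.TensorProduct.assoc k k k A A A).toAlgHom.comp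
      (Algebra.TensorProduct.map D (AlgHom.id k A))) (toConv ((inl k A A).toLinearMap ∘ₗ i)) =
      convPost χ (comulMap coact i j) := by
    refine Conv.ext_apply fun b => ?_
    have key : ∀ t : A ⊗[k] A, Algebra.TensorProduct.assoc k k k A A A (t ⊗ₜ 1) = χ t := by
      intro t
      induction t with
      | zero => simp
      | add s t hs ht => rw [add_tmul, map_add, map_add, hs, ht]
      | tmul a b => rfl
    refine Eq.trans ?_ (key _)
    simp [hi]
  have e₂ : convPost ((Algebra.TensorProduct.assoc k k k A A A).toAlgHom.comp
      (Algebra.TensorProduct.map D (AlgHom.id k A))) (toConv (coactMap coact i j)) =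
      toConv X₃ := by
    refine Conv.ext_apply fun b => ?_
    let K : H ⊗[k] (H ⊗[k] B) →ₗ[k] A ⊗[k] (A ⊗[k] A) :=
      TensorProduct.map j.toLinearMap (TensorProduct.map j.toLinearMap i)
    have h₁ : ∀ t : H ⊗[k] B, Algebra.TensorProduct.assoc k k k A A A
        (Algebra.TensorProduct.map D (AlgHom.id k A) (TensorProduct.map j.toLinearMap i t)) =
        K (TensorProduct.assoc k H H B (comul.rTensor B t)) := by
      intro t
      induction t with
      | zero => simp
      | add s t hs ht => simp only [map_add, hs, ht]
      | tmul a b =>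
        simp only [TensorProduct.map_tmul, AlgHom.toLinearMap_apply,
          Algebra.TensorProduct.map_tmul, hj, comulHom, AlgHom.comp_apply,
          Bialgebra.comulAlgHom_apply, LinearMap.rTensor_tmul]
        induction comul (R := k) a with
        | zero => simp
        | add s t hs ht => simp only [map_add, add_tmul, hs, ht]
        | tmul c d => simp [K]
    have h₂ : ∀ t : H ⊗[k] B, K (coact.lTensor H t) =
        TensorProduct.map j.toLinearMap (coactMap coact i j) t := by
      intro t
      induction t with
      | zero => simp
      | add s t hs ht => simp only [map_add, hs, ht]
      | tmul a b => rfl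
    exact (h₁ _).trans (congr(K ($hB.yetterDrinfeld.coassoc_coact b)).trans (h₂ _))
  have e₃ : convPost (Algebra.TensorProduct.map (AlgHom.id k A) D)
      (toConv ((inl k A A).toLinearMap ∘ₗ i)) =
      convPost χ (toConv ((inl k A A).toLinearMap ∘ₗ i)) := by
    refine Conv.ext_apply fun b => ?_
    simp [χ, Algebra.TensorProduct.one_def]
  have e₄ : convPost (Algebra.TensorProduct.map (AlgHom.id k A) D) (toConv (coactMap coact i j)) =
      convPost χ (toConv (coactMap coact i j)) * toConv X₃ := by
    refine Conv.ext_apply fun b => ?_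
    let G : B ⊗[k] B →ₗ[k] A ⊗[k] A :=
      TensorProduct.lift ((LinearMap.mul k (A ⊗[k] A)).compl₁₂ ((inl k A A).toLinearMap ∘ₗ i)
        (coactMap coact i j))
    have h₁ : ∀ t : H ⊗[k] B, Algebra.TensorProduct.map (AlgHom.id k A) D
        (TensorProduct.map j.toLinearMap i t) =
        TensorProduct.map j.toLinearMap G (comul.lTensor H t) := by
      intro t
      induction t with
      | zero => simp
      | add s t hs ht => simp only [map_add, hs, ht]
      | tmul a b => simp [hi, comulMap_apply, G]
    have h₂ : ∀ t : B ⊗[k] B, TensorProduct.map j.toLinearMap G (coactTensor coact coact t) =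
        LinearMap.mul' k _ (TensorProduct.map (χ.toLinearMap ∘ₗ coactMap coact i j) X₃ t) := by
      intro t
      induction t with
      | zero => simp
      | add s t hs ht => simp only [map_add, hs, ht]
      | tmul x y =>
        simp only [coactTensor, LinearMap.comp_apply, TensorProduct.map_tmul, LinearEquiv.coe_coe,
          LinearMap.mul'_apply, X₃, AlgHom.toLinearMap_apply, coactMap]
        induction coact x with
        | zero => simp
        | add s t hs ht => simp only [map_add, add_tmul, add_mul, hs, ht]
        | tmul a b =>
          induction coact y with
          | zero => simp
          | add s t hs ht => simp only [map_add, tmul_add, mul_add, hs, ht]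
          | tmul c d => simp [χ, G, coactMap]
    exact (h₁ _).trans (congr(TensorProduct.map j.toLinearMap G ($hB.comul_coact b)).trans (h₂ _))
  have e₅ : comulMap coact i j =
    toConv ((inl k A A).toLinearMap ∘ₗ i) * toConv (coactMap coact i j) := rfl
  conv_lhs => rw [e₅]
  conv_rhs => rw [e₅]
  rw [map_mul, map_mul, e₁, e₂, e₃, e₄, ← mul_assoc, ← map_mul, e₅]

include hA

/-- As Δ and ε extend to algebra homomorphisms, each coalgebra axiom compares two algebra
homomorphisms and has to be checked only on i(b) and j(h). -/
theorem isBialgebraStructure_of_smashPair (hs : Function.Surjective (smashLift i j))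
    {Δ : A →ₗ[k] A ⊗[k] A} {ε : A →ₗ[k] k}
    (hΔ : ∀ b h, Δ (i b * j h) = comulMap coact i j b * comulHom j h)
    (hε : ∀ b h, ε (i b * j h) = counit (R := k) b * counit (R := k) h) :
    IsBialgebraStructure (LinearMap.mul k A) 1 Δ ε := by
  let D : A →ₐ[k] A ⊗[k] A := hA.algHom hs (isSmashPair_comul hB hA) Δ hΔ
  let e : A →ₐ[k] k := hA.algHom hs (isSmashPair_counit hB) ε hε
  have hDi : ∀ b, D (i b) = comulMap coact i j b := fun b => by
    have h := hΔ b 1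
    rwa [map_one, map_one, mul_one, mul_one] at h
  have hDj : ∀ h, D (j h) = comulHom j h := fun h => by
    have h := hΔ one h
    rwa [hA.map_one, comulMap_one hB hA, one_mul, one_mul] at h
  have hei : ∀ b, e (i b) = counit (R := k) b := fun b => by
    have h := hε b 1
    rwa [map_one, Bialgebra.counit_one, mul_one, mul_one] at h
  have hej : ∀ h, e (j h) = counit (R := k) h := fun h => by
    have h := hε one h
    rwa [hA.map_one, hB.counit_one, one_mul, one_mul] at h
  refine
    { mul_assoc := mul_assoc
      one_mul := one_mul
      mul_one := mul_one
      coassoc := ?_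
      rTensor_counit_comp_comul := ?_
      lTensor_counit_comp_comul := ?_
      counit_one := map_one e
      counit_mul := map_mul e
      comul_one := map_one D
      comul_mul := fun x y => (map_mul D x y).trans (map₂_mul_mul _ _).symm }
  · have h : ((Algebra.TensorProduct.assoc k k k A A A).toAlgHom.comp
        (Algebra.TensorProduct.map D (AlgHom.id k A))).comp D =
        (Algebra.TensorProduct.map (AlgHom.id k A) D).comp D := by
      refine smashLift_algHom_ext hs (fun b => ?_) (fun h => ?_)
      · rw [AlgHom.comp_apply _ D, AlgHom.comp_apply _ D, hDi]
        exact congr($(convPost_comulMap hB D hDi hDj) b)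
      · have h₁ : ∀ t : H ⊗[k] H, Algebra.TensorProduct.assoc k k k A A A
            (Algebra.TensorProduct.map D (AlgHom.id k A) (Algebra.TensorProduct.map j j t)) =
            TensorProduct.map j.toLinearMap (TensorProduct.map j.toLinearMap j.toLinearMap)
              (TensorProduct.assoc k H H H (comul.rTensor H t)) := by
          intro t
          induction t with
          | zero => simp
          | add s t hs ht => simp only [map_add, hs, ht]
          | tmul a b =>
            simp only [Algebra.TensorProduct.map_tmul, hDj, comulHom, AlgHom.comp_apply,
              Bialgebra.comulAlgHom_apply, LinearMap.rTensor_tmul]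
            induction comul (R := k) a with
            | zero => simp
            | add s t hs ht => simp only [map_add, add_tmul, hs, ht]
            | tmul c d => simp
        have h₂ : ∀ t : H ⊗[k] H, Algebra.TensorProduct.map (AlgHom.id k A) D
            (Algebra.TensorProduct.map j j t) =
            TensorProduct.map j.toLinearMap (TensorProduct.map j.toLinearMap j.toLinearMap)
              (comul.lTensor H t) := by
          intro t
          induction t with
          | zero => simp
          | add s t hs ht => simp only [map_add, hs, ht]
          | tmul a b =>
            simp only [Algebra.TensorProduct.map_tmul, hDj, comulHom, AlgHom.comp_apply,
              Bialgebra.comulAlgHom_apply, LinearMap.lTensor_tmul, TensorProduct.map_tmul]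
            rfl
        rw [AlgHom.comp_apply _ D, AlgHom.comp_apply _ D, hDj]
        refine (h₁ _).trans (Eq.trans ?_ (h₂ _).symm)
        simp
    exact congr(AlgHom.toLinearMap $h)
  · have h : (Algebra.TensorProduct.map e (AlgHom.id k A)).comp D = inr k k A := by
      refine smashLift_algHom_ext hs (fun b => ?_) (fun h => ?_)
      · have h₁ : convPost (Algebra.TensorProduct.map e (AlgHom.id k A))
            (toConv ((inl k A A).toLinearMap ∘ₗ i)) = (1 : Conv k B (k ⊗[k] A)) :=
          Conv.ext_apply fun b => by simp [hei, Algebra.TensorProduct.algebraMap_apply]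
        have h₂ : ∀ t : H ⊗[k] B, Algebra.TensorProduct.map e (AlgHom.id k A)
            (TensorProduct.map j.toLinearMap i t) =
            i.lTensor k ((counit (R := k) (A := H)).rTensor B t) := by
          intro t
          induction t with
          | zero => simp
          | add s t hs ht => simp only [map_add, hs, ht]
          | tmul a b => simp [hej]
        have h₃ : convPost (Algebra.TensorProduct.map e (AlgHom.id k A)) (comulMap coact i j) =
            convPost (Algebra.TensorProduct.map e (AlgHom.id k A))
              (toConv (coactMap coact i j)) := by
          rw [comulMap, map_mul, h₁, one_mul]
        rw [AlgHom.comp_apply, hDi]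
        refine Eq.trans congr($h₃ b) ((h₂ _).trans ?_)
        rw [hB.yetterDrinfeld.counit_coact]
        rfl
      · have h₁ : ∀ t : H ⊗[k] H, Algebra.TensorProduct.map e (AlgHom.id k A)
            (Algebra.TensorProduct.map j j t) =
            j.toLinearMap.lTensor k ((counit (R := k) (A := H)).rTensor H t) := by
          intro t
          induction t with
          | zero => simp
          | add s t hs ht => simp only [map_add, hs, ht]
          | tmul a b => simp [hej]
        rw [AlgHom.comp_apply, hDj]
        refine (h₁ _).trans ?_
        simp
    exact congr(AlgHom.toLinearMap $h)
  · have h : (Algebra.TensorProduct.map (AlgHom.id k A) e).comp D = inl k A k := by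
      refine smashLift_algHom_ext hs (fun b => ?_) (fun h => ?_)
      · have h₂ : ∀ t : H ⊗[k] B, Algebra.TensorProduct.map (AlgHom.id k A) e
            (TensorProduct.map j.toLinearMap i t) =
            j.toLinearMap.rTensor k ((counit (R := k) (A := B)).lTensor H t) := by
          intro t
          induction t with
          | zero => simp
          | add s t hs ht => simp only [map_add, hs, ht]
          | tmul a b => simp [hei]
        have h₁ : convPost (Algebra.TensorProduct.map (AlgHom.id k A) e)
            (toConv (coactMap coact i j)) = (1 : Conv k B (A ⊗[k] k)) :=
          Conv.ext_apply fun b => by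
            refine (h₂ _).trans ?_
            rw [hB.counit_coact]
            simp [Algebra.algebraMap_eq_smul_one, Algebra.TensorProduct.one_def, ← tmul_smul]
        have h₃ : convPost (Algebra.TensorProduct.map (AlgHom.id k A) e) (comulMap coact i j) =
            convPost (Algebra.TensorProduct.map (AlgHom.id k A) e)
              (toConv ((inl k A A).toLinearMap ∘ₗ i)) := by
          rw [comulMap, map_mul, h₁, mul_one]
        rw [AlgHom.comp_apply, hDi]
        refine Eq.trans congr($h₃ b) ?_
        simp
      · have h₁ : ∀ t : H ⊗[k] H, Algebra.TensorProduct.map (AlgHom.id k A) e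
            (Algebra.TensorProduct.map j j t) =
            j.toLinearMap.rTensor k ((counit (R := k) (A := H)).lTensor H t) := by
          intro t
          induction t with
          | zero => simp
          | add s t hs ht => simp only [map_add, hs, ht]
          | tmul a b => simp [hej]
        rw [AlgHom.comp_apply, hDj]
        refine (h₁ _).trans ?_
        simp
    exact congr(AlgHom.toLinearMap $h)

end

/-! ### The antipode of the bosonisation -/

section

variable {k H B A X : Type*} [Field k] [Ring H] [HopfAlgebra k H] [AddCommGroup B] [Module k B]
  [Ring A] [Algebra k A] [Ring X] [Algebra k X]
  {act : H →ₗ[k] B →ₗ[k] B} {mul : B →ₗ[k] B →ₗ[k] B} {one : B} [Coalgebra k B]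
  {coact : B →ₗ[k] H ⊗[k] B} {S : B →ₗ[k] B}
  (hB : IsYetterDrinfeldHopf act coact mul one S) {i : B →ₗ[k] A} {j : H →ₐ[k] A}
  (hA : IsSmashPair act mul one i j)

variable (coact S i j) in
/-- The map `b ↦ j(T(b₋₁)) i(S(b₀))`. -/
def antipodeMap : B →ₗ[k] A :=
  TensorProduct.lift ((LinearMap.mul k A).compl₁₂ (j.toLinearMap ∘ₗ HopfAlgebra.antipode k)
    (i ∘ₗ S)) ∘ₗ coact

include hB

/-- `j(b₋₁) s(b₀) = i(S(b))` where `s(b) = j(T(b₋₁)) i(S(b₀))`. -/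
theorem lift_antipodeMap (b : B) : TensorProduct.lift ((LinearMap.mul k A).compl₁₂ j.toLinearMap
    (antipodeMap coact S i j)) (coact b) = i (S b) := by
  -- `K` sends p ⊗ q ⊗ c to j(p) j(T(q)) i(S(c)). Rebracketing the iterated coaction brings p and q
  -- together as h₁ T(h₂).
  let K : H ⊗[k] (H ⊗[k] B) →ₗ[k] A :=
    TensorProduct.lift ((LinearMap.mul k A).compl₁₂ j.toLinearMap
      (TensorProduct.lift ((LinearMap.mul k A).compl₁₂ (j.toLinearMap ∘ₗ HopfAlgebra.antipode k)
        (i ∘ₗ S))))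
  have h₁ : ∀ t : H ⊗[k] B, TensorProduct.lift ((LinearMap.mul k A).compl₁₂ j.toLinearMap
      (antipodeMap coact S i j)) t = K (coact.lTensor H t) := by
    intro t
    induction t with
    | zero => simp
    | add s t hs ht => simp only [map_add, hs, ht]
    | tmul a b => rfl
  have h₂ : ∀ t : H ⊗[k] B, K (TensorProduct.assoc k H H B (comul.rTensor B t)) =
      i (S (TensorProduct.lid k B ((counit (R := k) (A := H)).rTensor B t))) := by
    intro t
    induction t with
    | zero => simp
    | add s t hs ht => simp only [map_add, hs, ht]
    | tmul a b =>
      have h := congrArg (fun x => j x * i (S b)) (HopfAlgebra.sum_mul_antipode_eq_smul (ℛ k a))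
      rw [LinearMap.rTensor_tmul]
      conv_lhs => rw [← (ℛ k a).eq]
      simpa [sum_tmul, K, Finset.sum_mul, mul_assoc] using h
  refine (h₁ _).trans (congr(K ($hB.yetterDrinfeld.coassoc_coact b)).symm.trans ((h₂ _).trans ?_))
  rw [hB.yetterDrinfeld.counit_coact]
  simp

include hA

/-- `j(T((b₂)₋₁)) s(b₁) i((b₂)₀) = ε(b) 1` where `s(b) = j(T(b₋₁)) i(S(b₀))`. -/
theorem sum_antipodeMap_mul (b : B) : ∑ x ∈ (ℛ k b).index,
    TensorProduct.lift ((LinearMap.mul k A).compl₁₂ (j.toLinearMap ∘ₗ HopfAlgebra.antipode k)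
      (LinearMap.mulLeft k (antipodeMap coact S i j ((ℛ k b).left x)) ∘ₗ i))
        (coact ((ℛ k b).right x)) = counit (R := k) b • (1 : A) := by
  -- Antimultiplicativity of T merges the two coaction legs into the diagonal coaction of b₁ ⊗ b₂.
  -- Colinearity of Δ then leaves S(c₁) c₂ for c = b₀, which collapses.
  let Q : H ⊗[k] (B ⊗[k] B) →ₗ[k] A :=
    TensorProduct.lift ((LinearMap.mul k A).compl₁₂ (j.toLinearMap ∘ₗ HopfAlgebra.antipode k)
      (TensorProduct.lift ((LinearMap.mul k A).compl₁₂ (i ∘ₗ S) i)))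
  have h₁ : ∀ x y, TensorProduct.lift ((LinearMap.mul k A).compl₁₂
      (j.toLinearMap ∘ₗ HopfAlgebra.antipode k)
      (LinearMap.mulLeft k (antipodeMap coact S i j x) ∘ₗ i)) (coact y) =
      Q (coactTensor coact coact (x ⊗ₜ y)) := by
    intro x y
    simp only [coactTensor, LinearMap.comp_apply, TensorProduct.map_tmul, LinearEquiv.coe_coe,
      antipodeMap]
    induction coact y with
    | zero => simp
    | add s t hs ht => simp only [map_add, tmul_add, hs, ht]
    | tmul a c =>
      induction coact x with
      | zero => simp
      | add s t hs ht =>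
        simp only [map_add, add_tmul, ← hs, ← ht]
        simp [add_mul, mul_add]
      | tmul d e => simp [Q, HopfAlgebra.antipode_mul_antidistrib, mul_assoc]
  have h₂ : ∀ t : H ⊗[k] B, Q (comul.lTensor H t) =
      TensorProduct.rid k A ((j.toLinearMap ∘ₗ HopfAlgebra.antipode k).rTensor k
        ((counit (R := k) (A := B)).lTensor H t)) := by
    intro t
    induction t with
    | zero => simp
    | add s t hs ht => simp only [map_add, hs, ht]
    | tmul a c =>
      have h := congr(i $(hB.antipode.left_inv c))
      rw [← (ℛ k c).eq] at h
      simp only [map_sum, LinearMap.rTensor_tmul, TensorProduct.lift.tmul, hA.map_mul, map_smul,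
        hA.map_one] at h
      rw [LinearMap.lTensor_tmul, ← (ℛ k c).eq, tmul_sum, map_sum]
      simp only [Q, TensorProduct.lift.tmul, LinearMap.compl₁₂_apply, LinearMap.comp_apply,
        LinearMap.mul_apply', ← Finset.mul_sum, h]
      simp
  simp only [h₁]
  rw [← map_sum, ← map_sum, (ℛ k b).eq]
  refine congr(Q ($hB.comul_coact b)).symm.trans ((h₂ _).trans ?_)
  rw [hB.counit_coact]
  simp

/-- Antimultiplicativity of the antipode of A is not required: on i(b) j(h) the factors from H
cancel by the antipode identities of H, and those from B by `sum_antipodeMap_mul` and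
`lift_antipodeMap`. -/
theorem isAntipode_of_smashPair (hs : Function.Surjective (smashLift i j))
    {Δ : A →ₗ[k] A ⊗[k] A} {ε : A →ₗ[k] k} {T : A →ₗ[k] A}
    (hΔ : ∀ b h, Δ (i b * j h) = comulMap coact i j b * comulHom j h)
    (hε : ∀ b h, ε (i b * j h) = counit (R := k) b * counit (R := k) h)
    (hT : ∀ b h, T (i b * j h) = j (HopfAlgebra.antipode k h) * antipodeMap coact S i j b) :
    IsAntipode (LinearMap.mul k A) 1 Δ ε T := by
  have hcom : ∀ h, comulHom j h = ∑ x ∈ (ℛ k h).index,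
      j ((ℛ k h).left x) ⊗ₜ[k] j ((ℛ k h).right x) := fun h => by
    rw [comulHom, AlgHom.comp_apply, Bialgebra.comulAlgHom_apply, ← (ℛ k h).eq, map_sum]
    rfl
  have hanti : ∀ h, ∑ x ∈ (ℛ k h).index, j ((ℛ k h).left x) *
      j (HopfAlgebra.antipode k ((ℛ k h).right x)) = counit (R := k) h • (1 : A) := fun h => by
    have e := congrArg j (HopfAlgebra.sum_mul_antipode_eq_smul (ℛ k h))
    simpa only [map_sum, map_mul, map_smul, map_one] using e
  have hanti' : ∀ h, ∑ x ∈ (ℛ k h).index, j (HopfAlgebra.antipode k ((ℛ k h).left x)) *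
      j ((ℛ k h).right x) = counit (R := k) h • (1 : A) := fun h => by
    have e := congrArg j (HopfAlgebra.sum_antipode_mul_eq_smul (ℛ k h))
    simpa only [map_sum, map_mul, map_smul, map_one] using e
  have hcm : ∀ b, comulMap coact i j b = ∑ x ∈ (ℛ k b).index,
      (i ((ℛ k b).left x) ⊗ₜ[k] 1) * coactMap coact i j ((ℛ k b).right x) :=
    fun b => (ℛ k b).convMul_apply _ _
  constructor
  · have key : ∀ x y h, TensorProduct.lift (LinearMap.mul k A)
        (T.rTensor A ((i x ⊗ₜ[k] 1) * coactMap coact i j y * comulHom j h)) =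
        ∑ z ∈ (ℛ k h).index, j (HopfAlgebra.antipode k ((ℛ k h).left z)) *
          (TensorProduct.lift ((LinearMap.mul k A).compl₁₂
            (j.toLinearMap ∘ₗ HopfAlgebra.antipode k)
            (LinearMap.mulLeft k (antipodeMap coact S i j x) ∘ₗ i)) (coact y) *
              j ((ℛ k h).right z)) := by
      intro x y h
      simp only [coactMap, LinearMap.comp_apply]
      induction coact y with
      | zero => simp
      | add s t hs ht =>
        simp only [map_add, mul_add, add_mul, hs, ht, Finset.sum_add_distrib]
      | tmul u w =>
        simp only [hcom, TensorProduct.map_tmul, AlgHom.toLinearMap_apply, Finset.mul_sum,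
          Algebra.TensorProduct.tmul_mul_tmul, map_sum, LinearMap.rTensor_tmul,
          TensorProduct.lift.tmul, LinearMap.mul_apply', one_mul]
        refine Finset.sum_congr rfl fun z _ => ?_
        rw [mul_assoc, ← map_mul, hT, HopfAlgebra.antipode_mul_antidistrib, map_mul]
        simp [mul_assoc]
    refine fun a => congr($(smashLift_hom_ext hs (f := TensorProduct.lift (LinearMap.mul k A) ∘ₗ
      T.rTensor A ∘ₗ Δ) (g := LinearMap.toSpanSingleton k A 1 ∘ₗ ε) fun b h => ?_) a)
    simp only [LinearMap.comp_apply, hΔ, hε, LinearMap.toSpanSingleton_apply, hcm, Finset.sum_mul,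
      map_sum, key]
    rw [Finset.sum_comm]
    simp only [← Finset.mul_sum, ← Finset.sum_mul, sum_antipodeMap_mul hB hA, smul_mul_assoc,
      one_mul, mul_smul_comm, ← Finset.smul_sum, hanti', smul_smul]
  · have key : ∀ x y h, TensorProduct.lift (LinearMap.mul k A)
        (T.lTensor A ((i x ⊗ₜ[k] 1) * coactMap coact i j y * comulHom j h)) =
        counit (R := k) h • (i x * i (S y)) := by
      intro x y h
      rw [← lift_antipodeMap hB (i := i) (j := j)]
      simp only [coactMap, LinearMap.comp_apply]
      induction coact y with
      | zero => simp
      | add s t hs ht =>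
        simp only [map_add, mul_add, add_mul, hs, ht, smul_add]
      | tmul u w =>
        simp only [hcom, TensorProduct.map_tmul, AlgHom.toLinearMap_apply, Finset.mul_sum,
          Algebra.TensorProduct.tmul_mul_tmul, map_sum, LinearMap.lTensor_tmul,
          TensorProduct.lift.tmul, LinearMap.mul_apply', one_mul, hT, LinearMap.compl₁₂_apply]
        have e : ∀ z, i x * j u * j ((ℛ k h).left z) *
            (j (HopfAlgebra.antipode k ((ℛ k h).right z)) * antipodeMap coact S i j w) =
            i x * j u * (j ((ℛ k h).left z) * j (HopfAlgebra.antipode k ((ℛ k h).right z))) *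
              antipodeMap coact S i j w := fun z => by simp only [mul_assoc]
        simp only [e, ← Finset.mul_sum, ← Finset.sum_mul, hanti]
        simp [mul_assoc]
    refine fun a => congr($(smashLift_hom_ext hs (f := TensorProduct.lift (LinearMap.mul k A) ∘ₗ
      T.lTensor A ∘ₗ Δ) (g := LinearMap.toSpanSingleton k A 1 ∘ₗ ε) fun b h => ?_) a)
    simp only [LinearMap.comp_apply, hΔ, hε, LinearMap.toSpanSingleton_apply, hcm, Finset.sum_mul,
      map_sum, key]
    have e := congr(i $(hB.antipode.right_inv b))
    rw [← (ℛ k b).eq] at e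
    simp only [map_sum, LinearMap.lTensor_tmul, TensorProduct.lift.tmul, hA.map_mul, map_smul,
      hA.map_one] at e
    rw [← Finset.smul_sum, e, smul_smul, mul_comm]

end

section

variable {k H : Type*} [Field k] [Ring H] [HopfAlgebra k H]

/-- `Δ(T(a)) = T(a₂) ⊗ T(a₁)` -/
theorem comul_antipode (a : H) : comul (R := k) (HopfAlgebra.antipode k a) =
    TensorProduct.map (HopfAlgebra.antipode k) (HopfAlgebra.antipode k)
      (TensorProduct.comm k H H (comul a)) := by
  -- Inverting Δ = ι₁ ι₂ in the convolution group reverses the two factors.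
  have h := congr(Units.val ($(hopfUnit_comp_comul (AlgHom.id k (H ⊗[k] H))))⁻¹ a)
  rw [mul_inv_rev, Units.val_mul, (ℛ k a).convMul_apply] at h
  conv_rhs => rw [← (ℛ k a).eq]
  simpa using h

end

/-! ### The smash product on the tensor product -/

section

variable {k H B : Type*} [Field k] [Ring H] [HopfAlgebra k H] [AddCommGroup B] [Module k B]
  {act : H →ₗ[k] B →ₗ[k] B} {mul : B →ₗ[k] B →ₗ[k] B} {one : B} [Coalgebra k B]
  {coact : B →ₗ[k] H ⊗[k] B} {S : B →ₗ[k] B}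
  (hB : IsYetterDrinfeldHopf act coact mul one S)

/-- The action as a representation. -/
def IsYetterDrinfeldHopf.actRep : H →ₐ[k] Module.End k B :=
  AlgHom.ofLinearMap act (LinearMap.ext hB.yetterDrinfeld.one_act)
    fun a b => LinearMap.ext (hB.yetterDrinfeld.mul_act a b)

/-- The representation of `H` on `B ⊗ H`. -/
def IsYetterDrinfeldHopf.smashRep : H →ₐ[k] Module.End k (B ⊗[k] H) :=
  (Module.endTensorEndAlgHom.comp (Algebra.TensorProduct.map hB.actRep (Algebra.lmul k H))).comp
    (Bialgebra.comulAlgHom k H)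

theorem IsYetterDrinfeldHopf.smashRep_eq :
    hB.smashRep.toLinearMap = actTensor act (LinearMap.mul k H) := by
  refine LinearMap.ext fun h => ?_
  have key : ∀ t : H ⊗[k] H, Module.endTensorEndAlgHom (R := k) (S := k) (A := k) (M := B)
      (N := H) (Algebra.TensorProduct.map hB.actRep (Algebra.lmul k H) t) =
      TensorProduct.map₂ act (LinearMap.mul k H) t := by
    intro t
    induction t with
    | zero => simp
    | add s t hs ht => simp only [map_add, hs, ht]
    | tmul a b => rfl
  exact key _

/-- Exhibits left multiplication by b ⊗ h as an operator of the form φ(b) ψ(h), in preparation for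
associativity. -/
theorem IsYetterDrinfeldHopf.smashMul_eq :
    smashMul act mul = smashLift (LinearMap.rTensorHom H ∘ₗ mul) hB.smashRep := by
  rw [smashLift, hB.smashRep_eq]
  rfl

/-- The diagonal action is a product L₁ L₂ over the two tensor factors. L₂ commutes with
multiplication by b, and L₁ obeys the smash relation because the product of B is H-linear. -/
theorem IsYetterDrinfeldHopf.isSmashPair_smashRep :
    IsSmashPair act mul one (LinearMap.rTensorHom H ∘ₗ mul) hB.smashRep where
  map_mul x y := TensorProduct.ext' fun b h => by simp [hB.mul_assoc]
  map_one := TensorProduct.ext' fun b h => by simp [hB.one_mul]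
  comm h b := by
    let φ : B →ₗ[k] Module.End k (B ⊗[k] H) := LinearMap.rTensorHom H ∘ₗ mul
    let F := (Module.endTensorEndAlgHom (R := k) (S := k) (A := k) (M := B) (N := H)).comp
      (Algebra.TensorProduct.map hB.actRep (Algebra.lmul k H))
    let L₁ : Conv k H (Module.End k (B ⊗[k] H)) := (hopfUnit (F.comp (inl k H H))).val
    let L₂ : Conv k H (Module.End k (B ⊗[k] H)) := (hopfUnit (F.comp (inr k H H))).val
    have e : toConv hB.smashRep.toLinearMap = L₁ * L₂ :=
      congr(Units.val $(hopfUnit_comp_comul F))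
    have h₂ : ∀ a, L₂ a * φ b = φ b * L₂ a := fun a =>
      TensorProduct.ext' fun c d => by
        simp [L₂, F, φ, Module.endTensorEndAlgHom_apply]
    have h₁ : toConv (LinearMap.mulRight k (φ b) ∘ₗ L₁.ofConv) =
        toConv (φ ∘ₗ act.flip b) * L₁ := by
      refine Conv.ext_apply fun a => ?_
      rw [(ℛ k a).convMul_apply]
      refine TensorProduct.ext' fun c d => ?_
      have h := congr($(hB.act_mul a) (b ⊗ₜ c))
      rw [LinearMap.comp_apply, LinearMap.comp_apply, actTensor, LinearMap.comp_apply,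
        ← (ℛ k a).eq] at h
      simp only [map_sum, LinearMap.sum_apply, TensorProduct.lift.tmul,
        TensorProduct.map₂_apply_tmul, TensorProduct.map_tmul] at h
      simp [L₁, F, φ, IsYetterDrinfeldHopf.actRep, Module.endTensorEndAlgHom_apply, h, sum_tmul]
    have h₃ : toConv (LinearMap.mulRight k (φ b) ∘ₗ hB.smashRep.toLinearMap) =
        toConv (φ ∘ₗ act.flip b) * toConv hB.smashRep.toLinearMap := by
      rw [e, ← _root_.mul_assoc, ← h₁]
      refine Conv.ext_apply fun a => ?_
      rw [(ℛ k a).convMul_apply]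
      have h := congr($e a * φ b)
      rw [(ℛ k a).convMul_apply, Finset.sum_mul] at h
      refine h.trans (Finset.sum_congr rfl fun x _ => ?_)
      rw [_root_.mul_assoc, h₂, ← _root_.mul_assoc]
      rfl
    refine congr($h₃ h).trans ?_
    rw [(ℛ k h).convMul_apply]
    rfl

omit [Coalgebra k B] in
theorem smashMul_tmul_tmul (b c : B) (h g : H) : smashMul act mul (b ⊗ₜ h) (c ⊗ₜ g) =
    ∑ x ∈ (ℛ k h).index, mul b (act ((ℛ k h).left x) c) ⊗ₜ ((ℛ k h).right x * g) := by
  have e : actTensor act (LinearMap.mul k H) h (c ⊗ₜ g) =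
      ∑ x ∈ (ℛ k h).index, act ((ℛ k h).left x) c ⊗ₜ ((ℛ k h).right x * g) := by
    rw [actTensor, LinearMap.comp_apply]
    conv_lhs => rw [← (ℛ k h).eq]
    simp [LinearMap.sum_apply]
  refine congr((mul b).rTensor H $e).trans ?_
  simp

include hB

/-- Because left multiplications come from a smash pair of operators, x ↦ (x multiplied by -) sends
products to compositions. -/
theorem smashMul_assoc (x y z : B ⊗[k] H) :
    smashMul act mul (smashMul act mul x y) z = smashMul act mul x (smashMul act mul y z) := by
  have h : ∀ b h c g, smashMul act mul (smashMul act mul (b ⊗ₜ[k] h) (c ⊗ₜ[k] g)) =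
      smashMul act mul (b ⊗ₜ h) * smashMul act mul (c ⊗ₜ g) := by
    intro b h c g
    have hs := hB.isSmashPair_smashRep
    rw [smashMul_tmul_tmul, hB.smashMul_eq]
    simp only [map_sum, smashLift_tmul, hs.map_mul, _root_.map_mul]
    rw [mul_assoc, ← mul_assoc (hB.smashRep h), hs.comm, Finset.sum_mul, Finset.mul_sum]
    simp only [mul_assoc]
  induction x with
  | zero => simp
  | add s t hs ht => simp only [map_add, LinearMap.add_apply, hs, ht]
  | tmul b h' =>
    induction y with
    | zero => simp
    | add s t hs ht => simp only [map_add, LinearMap.add_apply, hs, ht]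
    | tmul c g => exact congr($(h b h' c g) z)

theorem one_smashMul (x : B ⊗[k] H) : smashMul act mul (one ⊗ₜ 1) x = x := by
  rw [hB.smashMul_eq, smashLift_tmul, hB.isSmashPair_smashRep.map_one, map_one]
  rfl

theorem smashMul_tmul_one_one_tmul (b : B) (h : H) :
    smashMul act mul (b ⊗ₜ 1) (one ⊗ₜ h) = b ⊗ₜ h := by
  rw [hB.smashMul_eq, smashLift_tmul, map_one]
  simp [hB.mul_one]

theorem smashMul_one (x : B ⊗[k] H) : smashMul act mul x (one ⊗ₜ 1) = x := by
  induction x with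
  | zero => simp
  | add s t hs ht => simp only [map_add, LinearMap.add_apply, hs, ht]
  | tmul b h =>
    rw [smashMul_tmul_tmul]
    simp only [hB.act_one, map_smul, hB.mul_one, mul_one]
    simp only [smul_tmul]
    rw [← tmul_sum, sum_counit_smul]

/-- The ring structure of the smash product. -/
abbrev smashRing : Ring (B ⊗[k] H) where
  __ := (inferInstance : AddCommGroup (B ⊗[k] H))
  mul x y := smashMul act mul x y
  one := one ⊗ₜ 1
  mul_assoc := smashMul_assoc hB
  one_mul := one_smashMul hB
  mul_one := smashMul_one hB
  left_distrib x y z := map_add (smashMul act mul x) y z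
  right_distrib x y z := LinearMap.map_add₂ (smashMul act mul) x y z
  zero_mul x := LinearMap.map_zero₂ (smashMul act mul) x
  mul_zero x := map_zero (smashMul act mul x)

/-- The algebra structure of the smash product. -/
abbrev smashAlgebra : letI := smashRing hB; Algebra k (B ⊗[k] H) :=
  letI := smashRing hB
  Algebra.ofModule (fun r x y => LinearMap.map_smul₂ (smashMul act mul) r x y)
    (fun r x y => map_smul (smashMul act mul x) r y)

/-- The inclusion of `H` into the smash product. -/
def smashInr : letI := smashRing hB; letI := smashAlgebra hB; H →ₐ[k] B ⊗[k] H :=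
  letI := smashRing hB
  letI := smashAlgebra hB
  AlgHom.ofLinearMap (TensorProduct.mk k B H one) rfl fun g h => by
    refine Eq.symm ((smashMul_tmul_tmul one one g h).trans ?_)
    simp only [hB.act_one, map_smul, hB.mul_one, smul_tmul]
    rw [← tmul_sum]
    simp only [← smul_mul_assoc, ← Finset.sum_mul, sum_counit_smul]
    rfl

theorem isSmashPair_smashInr : letI := smashRing hB; letI := smashAlgebra hB
    IsSmashPair act mul one ((TensorProduct.mk k B H).flip 1) (smashInr hB) :=
  letI := smashRing hB
  letI := smashAlgebra hB
  { map_mul := fun x y => by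
      have h : smashMul act mul (x ⊗ₜ[k] (1 : H)) (y ⊗ₜ 1) = mul x y ⊗ₜ 1 := by
        rw [hB.smashMul_eq, smashLift_tmul, _root_.map_one]
        simp
      exact h.symm
    map_one := rfl
    comm := fun h b => by
      refine (smashMul_tmul_tmul one b h 1).trans ?_
      refine Finset.sum_congr rfl fun x _ => ?_
      refine Eq.trans ?_ (smashMul_tmul_one_one_tmul hB _ _).symm
      rw [hB.one_mul, mul_one] }

theorem surjective_smashLift_smashInr : letI := smashRing hB; letI := smashAlgebra hB
    Function.Surjective (smashLift ((TensorProduct.mk k B H).flip 1) (smashInr hB)) := by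
  let := smashRing hB
  let := smashAlgebra hB
  intro t
  induction t with
  | zero => exact ⟨0, map_zero _⟩
  | add s t hs ht =>
    obtain ⟨x, rfl⟩ := hs
    obtain ⟨y, rfl⟩ := ht
    exact ⟨x + y, map_add _ _ _⟩
  | tmul b h => exact ⟨b ⊗ₜ h, smashMul_tmul_one_one_tmul hB b h⟩

theorem smashComul_eq (b : B) (h : H) : letI := smashRing hB; letI := smashAlgebra hB
    smashComul coact (b ⊗ₜ[k] h) =
      comulMap coact ((TensorProduct.mk k B H).flip 1) (smashInr hB) b *
        comulHom (smashInr hB) h := by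
  let := smashRing hB
  let := smashAlgebra hB
  have hij : ∀ b h, (b ⊗ₜ[k] (1 : H)) * smashInr hB h = b ⊗ₜ[k] h :=
    smashMul_tmul_one_one_tmul hB
  simp only [comulMap_apply, smashComul, comulHom, LinearMap.comp_apply, AlgHom.comp_apply,
    LinearMap.rTensor_tmul, Bialgebra.comulAlgHom_apply, LinearEquiv.coe_coe]
  induction comul (R := k) b with
  | zero => simp
  | add s t hs ht => simp only [add_tmul, map_add, hs, ht, add_mul]
  | tmul x y =>
    simp only [coactTensor, LinearMap.comp_apply, TensorProduct.assoc_tmul,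
      LinearMap.lTensor_tmul, TensorProduct.map_tmul, TensorProduct.lift.tmul, coactMap,
      LinearMap.compl₁₂_apply, LinearEquiv.coe_coe, LinearMap.mul_apply']
    induction coact y with
    | zero => simp
    | add s t hs ht => simp only [add_tmul, tmul_add, map_add, hs, ht, add_mul, mul_add]
    | tmul a c =>
      induction comul (R := k) h with
      | zero => simp
      | add s t hs ht => simp only [tmul_add, map_add, hs, ht, mul_add]
      | tmul d e =>
        have e₁ : x ⊗ₜ[k] a * smashInr hB d = x ⊗ₜ (a * d) := by
          rw [← hij, _root_.mul_assoc, ← _root_.map_mul, hij]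
        simp [hij, e₁]

theorem smashAntipode_eq (b : B) (h : H) : letI := smashRing hB; letI := smashAlgebra hB
    smashAntipode act coact S (b ⊗ₜ[k] h) =
      smashInr hB (HopfAlgebra.antipode k h) *
        antipodeMap coact S ((TensorProduct.mk k B H).flip 1) (smashInr hB) b := by
  let := smashRing hB
  let := smashAlgebra hB
  have key : ∀ (y : H) (c : B), TensorProduct.map (TensorProduct.lift
      (act.compl₁₂ (HopfAlgebra.antipode k) S)) (HopfAlgebra.antipode k)
      (TensorProduct.comm k H (H ⊗[k] B) (TensorProduct.assoc k H H B (comul y ⊗ₜ c))) =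
      smashInr hB (HopfAlgebra.antipode k y) * (S c ⊗ₜ[k] 1) := by
    intro y c
    have h₁ : smashInr hB (HopfAlgebra.antipode k y) * (S c ⊗ₜ[k] 1) =
        TensorProduct.map₂ act (LinearMap.mul k H) (comul (HopfAlgebra.antipode k y))
          (S c ⊗ₜ 1) := by
      refine Eq.trans (b := smashMul act mul (one ⊗ₜ HopfAlgebra.antipode k y) (S c ⊗ₜ 1)) rfl ?_
      rw [hB.smashMul_eq, smashLift_tmul, hB.isSmashPair_smashRep.map_one, _root_.one_mul]
      exact congr($hB.smashRep_eq (HopfAlgebra.antipode k y) (S c ⊗ₜ 1))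
    -- The flip in Δ(T(y)) = T(y₂) ⊗ T(y₁) accounts for the exchange of legs in `smashAntipode`.
    rw [h₁, comul_antipode]
    induction comul (R := k) y with
    | zero => simp
    | add s t hs ht => simp only [add_tmul, map_add, hs, ht, LinearMap.add_apply]
    | tmul d e => simp
  simp only [smashAntipode, antipodeMap, LinearMap.comp_apply, LinearMap.rTensor_tmul,
    LinearEquiv.coe_coe]
  induction coact b with
  | zero => simp
  | add s t hs ht => simp only [add_tmul, map_add, hs, ht, mul_add]
  | tmul a c =>
    simp only [TensorProduct.rightComm_tmul, LinearMap.rTensor_tmul, LinearMap.mul'_apply, key,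
      HopfAlgebra.antipode_mul_antidistrib, _root_.map_mul, TensorProduct.lift.tmul]
    rw [_root_.mul_assoc]
    rfl

theorem isBialgebraStructure_smash : IsBialgebraStructure (smashMul act mul)
    (one ⊗ₜ[k] (1 : H)) (smashComul coact) (smashCounit (k := k) (H := H) (B := B)) := by
  let := smashRing hB
  let := smashAlgebra hB
  refine isBialgebraStructure_of_smashPair hB (isSmashPair_smashInr hB)
    (surjective_smashLift_smashInr hB) (fun b h => ?_) (fun b h => ?_)
  · exact congr(smashComul coact $(smashMul_tmul_one_one_tmul hB b h)).trans
      (smashComul_eq hB b h)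
  · exact congr(smashCounit $(smashMul_tmul_one_one_tmul hB b h))

theorem isAntipode_smash : IsAntipode (smashMul act mul)
    (one ⊗ₜ[k] (1 : H)) (smashComul coact) (smashCounit (k := k) (H := H) (B := B))
    (smashAntipode act coact S) := by
  let := smashRing hB
  let := smashAlgebra hB
  refine isAntipode_of_smashPair hB (isSmashPair_smashInr hB)
    (surjective_smashLift_smashInr hB) (fun b h => ?_) (fun b h => ?_) (fun b h => ?_)
  · exact congr(smashComul coact $(smashMul_tmul_one_one_tmul hB b h)).trans
      (smashComul_eq hB b h)
  · exact congr(smashCounit $(smashMul_tmul_one_one_tmul hB b h))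
  · exact congr(smashAntipode act coact S $(smashMul_tmul_one_one_tmul hB b h)).trans
      (smashAntipode_eq hB b h)

end

/-! ### The explicit formulas -/

section

variable {k H : Type*} [Field k] [Ring H] [HopfAlgebra k H]

theorem Sweedler₃.comul_rTensor {ι : Type} [Fintype ι] {a : H} {a₁ a₂ a₃ : ι → H}
    (h : Sweedler₃ k a a₁ a₂ a₃) :
    comul.rTensor H (comul (R := k) a) = ∑ i, (a₁ i ⊗ₜ a₂ i) ⊗ₜ[k] a₃ i := by
  refine (TensorProduct.assoc k H H H).injective ?_
  rw [coassoc_apply, map_sum]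
  exact h

theorem comul₃_eq_assoc (a : H) :
    comul₃ k a = TensorProduct.assoc k H H H (comul.rTensor H (comul a)) :=
  (coassoc_apply a).symm

theorem comul₄_eq_assoc (a : H) : comul₄ k a =
    (TensorProduct.assoc k H H H).toLinearMap.lTensor H
      (TensorProduct.assoc k H (H ⊗[k] H) H ((comul₃ k).rTensor H (comul a))) := by
  have h : ∀ t : H ⊗[k] H, (TensorProduct.assoc k H H H).toLinearMap.lTensor H
      (TensorProduct.assoc k H (H ⊗[k] H) H ((comul₃ k).rTensor H t)) =
      ((TensorProduct.assoc k H H H).toLinearMap ∘ₗ comul.rTensor H).lTensor H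
        (TensorProduct.assoc k H H H (comul.rTensor H t)) := by
    intro t
    induction t with
    | zero => simp
    | add s t hs ht => simp only [map_add, hs, ht]
    | tmul a b =>
      simp only [LinearMap.rTensor_tmul, comul₃, LinearMap.comp_apply]
      induction comul (R := k) a with
      | zero => simp
      | add s t hs ht => simp only [map_add, add_tmul, hs, ht]
      | tmul c d => simp
  rw [h, coassoc_apply, ← LinearMap.comp_apply, ← LinearMap.lTensor_comp, LinearMap.comp_assoc,
    coassoc]
  rfl

/-- ρ keeps the middle leg of a₁ ⊗ a₂ ⊗ a₃, so splitting ρ's second leg splits that leg, whereas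
`comul₅` always splits the last one. Coassociativity reconciles the two. -/
theorem comul₅_eq_assoc (a : H) : comul₅ k a =
    ((TensorProduct.assoc k H H H).toLinearMap.lTensor H ∘ₗ
      (TensorProduct.assoc k H (H ⊗[k] H) H).toLinearMap).lTensor H
        (((comul₃ k).rTensor H).lTensor H (comul₃ k a)) := by
  have h : comul₄ k (H := H) = ((TensorProduct.assoc k H H H).toLinearMap.lTensor H ∘ₗ
      (TensorProduct.assoc k H (H ⊗[k] H) H).toLinearMap) ∘ₗ (comul₃ k).rTensor H ∘ₗ comul :=
    LinearMap.ext comul₄_eq_assoc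
  rw [comul₅, h, LinearMap.lTensor_comp, LinearMap.lTensor_comp _ ((comul₃ k).rTensor H)]
  rfl

theorem Sweedler₅.comul₃_rTensor {ι : Type} [Fintype ι] {a : H} {a₁ a₂ a₃ a₄ a₅ : ι → H}
    (h : Sweedler₅ k a a₁ a₂ a₃ a₄ a₅) : ((comul₃ k).rTensor H).lTensor H (comul₃ k a) =
      ∑ i, a₁ i ⊗ₜ[k] ((a₂ i ⊗ₜ[k] (a₃ i ⊗ₜ[k] a₄ i)) ⊗ₜ[k] a₅ i) := by
  let e := (TensorProduct.assoc k H (H ⊗[k] H) H).trans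
    ((TensorProduct.assoc k H H H).lTensor H)
  refine (e.lTensor H).injective (((comul₅_eq_assoc a).symm.trans h).trans ?_)
  rw [map_sum]
  rfl

variable (k H) in
/-- The map `x ⊗ (m ⊗ z) ↦ x T(z) ⊗ m`. -/
def conjLeg (M : Type*) [AddCommGroup M] [Module k M] : H ⊗[k] (M ⊗[k] H) →ₗ[k] H ⊗[k] M :=
  (LinearMap.mul' k H ∘ₗ (HopfAlgebra.antipode k).lTensor H).rTensor M ∘ₗ
    (TensorProduct.assoc k H H M).symm.toLinearMap ∘ₗ
    (TensorProduct.comm k M H).toLinearMap.lTensor H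

@[simp]
theorem conjLeg_tmul {M : Type*} [AddCommGroup M] [Module k M] (x z : H) (m : M) :
    conjLeg k H M (x ⊗ₜ (m ⊗ₜ z)) = (x * HopfAlgebra.antipode k z) ⊗ₜ m := rfl

theorem adjointCoaction_eq_conjLeg : adjointCoaction k H = conjLeg k H H ∘ₗ comul₃ k := rfl

theorem lTensor_comp_conjLeg {M N : Type*} [AddCommGroup M] [Module k M] [AddCommGroup N]
    [Module k N] (f : M →ₗ[k] N) :
    f.lTensor H ∘ₗ conjLeg k H M = conjLeg k H N ∘ₗ (f.rTensor H).lTensor H := by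
  ext
  rfl

theorem Sweedler₄.lTensor_adjointCoaction {ι : Type} [Fintype ι] {a : H} {a₁ a₂ a₃ a₄ : ι → H}
    (h : Sweedler₄ k a a₁ a₂ a₃ a₄) : (adjointCoaction k H).lTensor H (comul a) =
      ∑ i, a₁ i ⊗ₜ[k] ((a₂ i * HopfAlgebra.antipode k (a₄ i)) ⊗ₜ[k] a₃ i) := by
  have e := congr((conjLeg k H H).lTensor H $h)
  rw [adjointCoaction_eq_conjLeg, LinearMap.lTensor_comp]
  refine e.trans ?_
  rw [map_sum]
  rfl

theorem Sweedler₅.lTensor_comul₃_adjointCoaction {ι : Type} [Fintype ι] {a : H}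
    {a₁ a₂ a₃ a₄ a₅ : ι → H} (h : Sweedler₅ k a a₁ a₂ a₃ a₄ a₅) :
    (comul₃ k).lTensor H (adjointCoaction k H a) =
      ∑ i, (a₁ i * HopfAlgebra.antipode k (a₅ i)) ⊗ₜ[k] (a₂ i ⊗ₜ[k] (a₃ i ⊗ₜ[k] a₄ i)) := by
  have e := congr($(lTensor_comp_conjLeg (H := H) (comul₃ k (H := H))) (comul₃ k a))
  refine e.trans ?_
  rw [LinearMap.comp_apply, h.comul₃_rTensor, map_sum]
  rfl

/-- `Δ(a ⊗ h) = (a₁ ⊗ a₂ T(a₄) h₁) ⊗ (a₃ ⊗ h₂)` -/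
theorem smashComul_adjointCoaction (a h : H) {ι κ : Type} [Fintype ι] [Fintype κ]
    (a₁ a₂ a₃ a₄ : ι → H) (h₁ h₂ : κ → H)
    (ha : Sweedler₄ k a a₁ a₂ a₃ a₄) (hh : Sweedler₂ k h h₁ h₂) :
    smashComul (adjointCoaction k H) (a ⊗ₜ[k] h) =
      ∑ i, ∑ j, (a₁ i ⊗ₜ[k] (a₂ i * HopfAlgebra.antipode k (a₄ i) * h₁ j)) ⊗ₜ[k]
        (a₃ i ⊗ₜ[k] h₂ j) := by
  let K : H ⊗[k] (H ⊗[k] H) →ₗ[k] (H ⊗[k] H) ⊗[k] (H ⊗[k] H) :=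
    (TensorProduct.assoc k H H (H ⊗[k] H)).symm.toLinearMap ∘ₗ
      ((LinearMap.mul' k H).rTensor (H ⊗[k] H) ∘ₗ
        (TensorProduct.tensorTensorTensorComm k H H H H).toLinearMap ∘ₗ
        (TensorProduct.mk k (H ⊗[k] H) (H ⊗[k] H)).flip (comul h)).lTensor H
  have hK : ∀ t : H ⊗[k] H, (TensorProduct.assoc k H H (H ⊗[k] H)).symm
      ((coactTensor (adjointCoaction k H) comul).lTensor H (TensorProduct.assoc k H H H
        (t ⊗ₜ h))) = K ((adjointCoaction k H).lTensor H t) := by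
    intro t
    induction t with
    | zero => simp
    | add s t hs ht => simp only [add_tmul, map_add, hs, ht]
    | tmul x y => rfl
  refine (hK _).trans ?_
  rw [ha.lTensor_adjointCoaction, map_sum]
  refine Finset.sum_congr rfl fun i _ => ?_
  rw [Sweedler₂] at hh
  simp [K, hh, tmul_sum]

/-! ### The explicit product and antipode of the bosonisation -/

namespace MatchedPair

variable (P : MatchedPair k H)

/-- `(a ⊗ h) (a' ⊗ h') = a · S(h₁) · (h₂ a') ⊗ h₃ h'` -/
theorem smashMul_left_dot (a h a' h' : H) {ι : Type} [Fintype ι] (h₁ h₂ h₃ : ι → H)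
    (hh : Sweedler₃ k h h₁ h₂ h₃) : smashMul P.left P.dot (a ⊗ₜ[k] h) (a' ⊗ₜ[k] h') =
      ∑ i, P.dot (P.dot a (P.S (h₁ i))) (h₂ i * a') ⊗ₜ[k] (h₃ i * h') := by
  let G : H ⊗[k] H →ₗ[k] H := P.dot a ∘ₗ LinearMap.applyₗ a' ∘ₗ
    TensorProduct.lift ((LinearMap.mul k (Module.End k H)).compl₁₂ (P.dot ∘ₗ P.S)
      (LinearMap.mul k H))
  have hG : ∀ x, P.dot a (P.left x a') = G (comul x) :=
    fun x => congr(P.dot a $(P.sum_dot_S_mul x a')).symm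
  have key : ∀ t : H ⊗[k] H, TensorProduct.map (P.dot a ∘ₗ P.left.flip a')
      (LinearMap.mulRight k h') t =
      TensorProduct.map G (LinearMap.mulRight k h') (comul.rTensor H t) := by
    intro t
    induction t with
    | zero => simp
    | add s t hs ht => simp only [map_add, hs, ht]
    | tmul x y => simp [hG]
  -- The first leg of Δ(h) is split once more, by a ⇀ b = S(a₁) · (a₂ b).
  have e := key (comul h)
  rw [hh.comul_rTensor] at e
  conv_lhs at e => rw [← (ℛ k h).eq]
  rw [smashMul_tmul_tmul]
  simpa [G, P.dot_assoc] using e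

/-- Apply a ⇀ z = S(a₁) · (a₂ z) to a = T(T(q) g). Its coproduct is T(T(q₁) g₂) ⊗ T(T(q₂) g₁): two
applications of T restore the order of q, and one reverses that of g. -/
theorem left_antipode_antipode_mul (q g z : H) :
    P.left (HopfAlgebra.antipode k (HopfAlgebra.antipode k q * g)) z =
      TensorProduct.lift ((LinearMap.mul k (Module.End k H)).compl₁₂ (P.dot ∘ₗ P.S)
        (LinearMap.mul k H)) (TensorProduct.map₂
          (((LinearMap.mul k H).comp (HopfAlgebra.antipode k)).compr₂ (HopfAlgebra.antipode k))
          (((LinearMap.mul k H).comp (HopfAlgebra.antipode k)).compr₂ (HopfAlgebra.antipode k))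
          (comul q) (TensorProduct.comm k H H (comul g))) z := by
  rw [← P.sum_dot_S_mul, comul_antipode, Bialgebra.comul_mul, comul_antipode]
  congr 2
  induction comul (R := k) q with
  | zero => simp
  | add s t hs ht => simp only [map_add, add_mul, LinearMap.add_apply, hs, ht]
  | tmul a b =>
    induction comul (R := k) g with
    | zero => simp
    | add s t hs ht => simp only [map_add, mul_add, hs, ht]
    | tmul c d => simp

/-- The bilinear map `(c ⊗ d, h) ↦ T(c h) ⇀ S(d)`. -/
def antipodeLeg : H ⊗[k] H →ₗ[k] H →ₗ[k] H :=
  ((LinearMap.rTensorHom H ∘ₗ (LinearMap.mul k H).flip).compr₂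
    (TensorProduct.lift (P.left.compl₁₂ (HopfAlgebra.antipode k) P.S))).flip

@[simp]
theorem antipodeLeg_tmul (c d h : H) : P.antipodeLeg (c ⊗ₜ d) h =
    P.left (HopfAlgebra.antipode k (c * h)) (P.S d) := rfl

/-- The bilinear map `(b₁ ⊗ b₂ ⊗ b₃, g₁ ⊗ g₂) ↦ S(T(T(b₂) g₂)) · (T(T(b₃) g₁) T(b₁))`. -/
def antipodeLeg₃ : H ⊗[k] (H ⊗[k] H) →ₗ[k] H ⊗[k] H →ₗ[k] H :=
  TensorProduct.lift ((LinearMap.llcomp k (H ⊗[k] H) (Module.End k H) H ∘ₗ LinearMap.applyₗ ∘ₗ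
    HopfAlgebra.antipode k).compl₂ (((TensorProduct.map₂
      (((LinearMap.mul k H).comp (HopfAlgebra.antipode k)).compr₂ (HopfAlgebra.antipode k))
      (((LinearMap.mul k H).comp (HopfAlgebra.antipode k)).compr₂ (HopfAlgebra.antipode k))).compr₂
        (TensorProduct.lift ((LinearMap.mul k (Module.End k H)).compl₁₂ (P.dot ∘ₗ P.S)
          (LinearMap.mul k H)))).compl₂ (TensorProduct.comm k H H).toLinearMap))

@[simp]
theorem antipodeLeg₃_tmul (b₁ b₂ b₃ g₁ g₂ : H) :
    P.antipodeLeg₃ (b₁ ⊗ₜ (b₂ ⊗ₜ b₃)) (g₁ ⊗ₜ g₂) =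
      P.dot (P.S (HopfAlgebra.antipode k (HopfAlgebra.antipode k b₂ * g₂)))
        (HopfAlgebra.antipode k (HopfAlgebra.antipode k b₃ * g₁) * HopfAlgebra.antipode k b₁) :=
  rfl

/-- T(b₁ T(b₃) g) ⇀ S(b₂) equals T(T(b₃) g) ⇀ (T(b₁) ⇀ S(b₂)), and the inner action collapses by
T(b₁) ⇀ S(b₂) = T(b). What remains is `left_antipode_antipode_mul`. -/
theorem antipodeLeg_adjointCoaction (b g : H) :
    P.antipodeLeg (adjointCoaction k H b) g = P.antipodeLeg₃ (comul₃ k b) (comul g) := by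
  have h : ∀ t : H ⊗[k] H, P.antipodeLeg (conjLeg k H H (TensorProduct.assoc k H H H
      (comul.rTensor H t))) g = P.antipodeLeg₃ (comul.lTensor H t) (comul g) := by
    intro t
    induction t with
    | zero => simp
    | add s t hs ht => simp only [map_add, LinearMap.add_apply, hs, ht]
    | tmul p z =>
      have e := congr($P.left_antipode_convSmul_S p)
      rw [convSmul_apply] at e
      refine Eq.trans ?_ (P.left_antipode_antipode_mul z g (HopfAlgebra.antipode k p))
      rw [LinearMap.rTensor_tmul, ← (ℛ k p).eq, ← e]
      simp [sum_tmul, LinearMap.sum_apply, mul_assoc, P.mul_left,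
        HopfAlgebra.antipode_mul_antidistrib]
  rw [adjointCoaction_eq_conjLeg, LinearMap.comp_apply, comul₃_eq_assoc, h, ← comul₃_eq_assoc]
  rfl

/-- The coproduct of b₋₁ h splits multiplicatively, and coassociativity of the coaction trades
Δ(b₋₁) for a second coaction on b₀. -/
theorem smashAntipode_eq_antipodeLeg (a h : H) :
    smashAntipode P.left (adjointCoaction k H) P.S (a ⊗ₜ[k] h) =
      TensorProduct.comm k H H (TensorProduct.map₂
        ((LinearMap.mul k H).compr₂ (HopfAlgebra.antipode k)) P.antipodeLeg
        ((adjointCoaction k H).lTensor H (adjointCoaction k H a)) (comul h)) := by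
  have key : ∀ t : H ⊗[k] H, TensorProduct.map (TensorProduct.lift
        (P.left.compl₁₂ (HopfAlgebra.antipode k) P.S)) (HopfAlgebra.antipode k)
        (TensorProduct.comm k H (H ⊗[k] H) (TensorProduct.assoc k H H H
          (comul.rTensor H ((LinearMap.mul' k H).rTensor H
            (TensorProduct.rightComm k H H H (t ⊗ₜ h)))))) =
      TensorProduct.comm k H H (TensorProduct.map₂
        ((LinearMap.mul k H).compr₂ (HopfAlgebra.antipode k)) P.antipodeLeg
        (TensorProduct.assoc k H H H (comul.rTensor H t)) (comul h)) := by
    intro t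
    induction t with
    | zero => simp
    | add s t hs ht => simp only [map_add, add_tmul, LinearMap.add_apply, hs, ht]
    | tmul c d =>
      simp only [TensorProduct.rightComm_tmul, LinearMap.rTensor_tmul, LinearMap.mul'_apply,
        Bialgebra.comul_mul]
      induction comul (R := k) c with
      | zero => simp
      | add s t hs ht => simp only [map_add, add_mul, add_tmul, LinearMap.add_apply, hs, ht]
      | tmul x y =>
        induction comul (R := k) h with
        | zero => simp
        | add s t hs ht => simp only [map_add, mul_add, add_tmul, hs, ht]
        | tmul u v => simp
  refine (key _).trans ?_
  have e := congr($(adjointCoaction_coassoc k H) a)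
  simp only [LinearMap.comp_apply, LinearEquiv.coe_coe] at e
  rw [e]

/-- `S(a ⊗ h) = S(T(T(a₃) h₃)) · (T(T(a₄) h₂) T(a₂)) ⊗ T(a₁ T(a₅) h₁)` -/
theorem smashAntipode_left (a h : H) {ι κ : Type} [Fintype ι] [Fintype κ]
    (a₁ a₂ a₃ a₄ a₅ : ι → H) (h₁ h₂ h₃ : κ → H)
    (ha : Sweedler₅ k a a₁ a₂ a₃ a₄ a₅) (hh : Sweedler₃ k h h₁ h₂ h₃) :
    smashAntipode P.left (adjointCoaction k H) P.S (a ⊗ₜ[k] h) =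
      ∑ i, ∑ j,
        P.dot
          (P.S (HopfAlgebra.antipode k (HopfAlgebra.antipode k (a₃ i) * h₃ j)))
          (HopfAlgebra.antipode k (HopfAlgebra.antipode k (a₄ i) * h₂ j) *
            HopfAlgebra.antipode k (a₂ i)) ⊗ₜ[k]
        HopfAlgebra.antipode k (a₁ i * HopfAlgebra.antipode k (a₅ i) * h₁ j) := by
  -- Rewriting the inner coaction by `antipodeLeg_adjointCoaction` introduces one more splitting of
  -- h and a threefold splitting of the middle leg of a, hence three and five legs in all.
  have key : ∀ s t : H ⊗[k] H, TensorProduct.map₂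
        ((LinearMap.mul k H).compr₂ (HopfAlgebra.antipode k)) P.antipodeLeg
        ((adjointCoaction k H).lTensor H s) t =
      TensorProduct.map₂ ((LinearMap.mul k H).compr₂ (HopfAlgebra.antipode k)) P.antipodeLeg₃
        ((comul₃ k).lTensor H s) (comul.lTensor H t) := by
    intro s t
    induction s with
    | zero => simp
    | add s₁ s₂ e₁ e₂ => simp only [map_add, LinearMap.add_apply, e₁, e₂]
    | tmul x y =>
      induction t with
      | zero => simp
      | add t₁ t₂ e₁ e₂ => simp only [map_add, e₁, e₂]
      | tmul c d => simp [P.antipodeLeg_adjointCoaction]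
  have hh' : comul.lTensor H (comul (R := k) h) = ∑ j, h₁ j ⊗ₜ[k] (h₂ j ⊗ₜ[k] h₃ j) := hh
  rw [P.smashAntipode_eq_antipodeLeg, key, ha.lTensor_comul₃_adjointCoaction, hh']
  simp only [map_sum, LinearMap.sum_apply]
  exact Finset.sum_comm

end MatchedPair

end

end Bosonisation

end

theorem mainTheorem6 {k H : Type*} [Field k] [Ring H] [HopfAlgebra k H]
    (P : Bosonisation.MatchedPair k H) :
    -- the transmutation is a Hopf algebra in the Yetter–Drinfeld modules over `H`
    Bosonisation.IsYetterDrinfeldHopf P.left (Bosonisation.adjointCoaction k H) P.dot 1 P.S ∧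
    -- its bosonisation is a bialgebra structure on `H ⊗ H`, with antipode
    Bosonisation.IsBialgebraStructure (Bosonisation.smashMul P.left P.dot)
      ((1 : H) ⊗ₜ[k] (1 : H))
      (Bosonisation.smashComul (Bosonisation.adjointCoaction k H))
      (Bosonisation.smashCounit (k := k) (H := H) (B := H)) ∧
    Bosonisation.IsAntipode (Bosonisation.smashMul P.left P.dot)
      ((1 : H) ⊗ₜ[k] (1 : H))
      (Bosonisation.smashComul (Bosonisation.adjointCoaction k H))
      (Bosonisation.smashCounit (k := k) (H := H) (B := H))
      (Bosonisation.smashAntipode P.left (Bosonisation.adjointCoaction k H) P.S) ∧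
    -- `(a ⊗ h) (a' ⊗ h') = a · S(h₁) · (h₂ a') ⊗ h₃ h'`
    (∀ (a h a' h' : H) {ι : Type} [Fintype ι] (h₁ h₂ h₃ : ι → H),
      Bosonisation.Sweedler₃ k h h₁ h₂ h₃ →
      Bosonisation.smashMul P.left P.dot (a ⊗ₜ[k] h) (a' ⊗ₜ[k] h') =
        ∑ i, P.dot (P.dot a (P.S (h₁ i))) (h₂ i * a') ⊗ₜ[k] (h₃ i * h')) ∧
    -- `Δ(a ⊗ h) = (a₁ ⊗ a₂ T(a₄) h₁) ⊗ (a₃ ⊗ h₂)`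
    (∀ (a h : H) {ι κ : Type} [Fintype ι] [Fintype κ]
      (a₁ a₂ a₃ a₄ : ι → H) (h₁ h₂ : κ → H),
      Bosonisation.Sweedler₄ k a a₁ a₂ a₃ a₄ → Bosonisation.Sweedler₂ k h h₁ h₂ →
      Bosonisation.smashComul (Bosonisation.adjointCoaction k H) (a ⊗ₜ[k] h) =
        ∑ i, ∑ j, (a₁ i ⊗ₜ[k] (a₂ i * HopfAlgebra.antipode k (a₄ i) * h₁ j)) ⊗ₜ[k]
          (a₃ i ⊗ₜ[k] h₂ j)) ∧
    -- `S(a ⊗ h) = S(T(T(a₃) h₃)) · (T(T(a₄) h₂) T(a₂)) ⊗ T(a₁ T(a₅) h₁)`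
    (∀ (a h : H) {ι κ : Type} [Fintype ι] [Fintype κ]
      (a₁ a₂ a₃ a₄ a₅ : ι → H) (h₁ h₂ h₃ : κ → H),
      Bosonisation.Sweedler₅ k a a₁ a₂ a₃ a₄ a₅ → Bosonisation.Sweedler₃ k h h₁ h₂ h₃ →
      Bosonisation.smashAntipode P.left (Bosonisation.adjointCoaction k H) P.S (a ⊗ₜ[k] h) =
        ∑ i, ∑ j,
          P.dot
            (P.S (HopfAlgebra.antipode k (HopfAlgebra.antipode k (a₃ i) * h₃ j)))
            (HopfAlgebra.antipode k (HopfAlgebra.antipode k (a₄ i) * h₂ j) *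
              HopfAlgebra.antipode k (a₂ i)) ⊗ₜ[k]
          HopfAlgebra.antipode k (a₁ i * HopfAlgebra.antipode k (a₅ i) * h₁ j)) := by
  have h := P.isYetterDrinfeldHopf
  exact ⟨h, Bosonisation.isBialgebraStructure_smash h, Bosonisation.isAntipode_smash h,
    P.smashMul_left_dot, Bosonisation.smashComul_adjointCoaction, P.smashAntipode_left⟩
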